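/- **Setting.** Let $f:\mathbb R^d\to\mathbb R$ be twice continuously differentiable, bounded below by $f_{\rm low}$, with $\{x: f(x)\le f(x_0)\}$ compact. Let $L_g,L_H,\eta,U_H>0$, $\zeta\in(0,\min\{1,U_H\})$, $\tilde\theta\in((2-\sqrt3)^2,1)$, $\delta\in[0,1)$, $\delta_H\in\mathbb R$, $\epsilon>0$, and put $\epsilon_g=\epsilon$, $\epsilon_H=\sqrt{L_H\epsilon}$. Norms are Euclidean or spectral; $\mathrm{sgn}(t)\in\{-1,1\}$ is the sign of $t$, and $\mathrm{sgn}(0)$ may be either value. **Procedure 1 (capped CG)**, for a symmetric matrix $H$, $g\neq0$, damping $\epsilon_H$, accuracy $\zeta$ and bound $M$. Put $\bar H=H+2\epsilon_H I$, $\kappa=(M+2\epsilon_H)/\epsilon_H$, $\hat\zeta=\zeta/(3\kappa)$, $\tau=1/(\sqrt\kappa+1)$, $T=4\kappa^4/(1-\sqrt{1-\tau})^2$, $y_0=0$, $r_0=g$, $p_0=-g$. If $p_0^T\bar Hp_0<\epsilon_H\|p_0\|^2$, return $(\mathrm{NC},p_0)$; otherwise increase $M$ to $\|Hp_0\|/\|p_0\|$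 if that is larger. For $j=1,2,\dots$: do one standard CG step for $\bar Hy=-g$, giving $y_j,r_j,p_j$; increase $M$ (and update $\kappa,\hat\zeta,\tau,T$) to $\max(\|Hp_j\|/\|p_j\|,\|Hy_j\|/\|y_j\|,\|Hr_j\|/\|r_j\|)$ if that is larger; then apply the first test that holds: (i) if $y_j^T\bar Hy_j\le\epsilon_H\|y_j\|^2$, return $(\mathrm{NC},y_j)$; (ii) if $\|r_j\|\le\hat\zeta\|r_0\|$, return $(\mathrm{SOL},y_j)$; (iii) if $p_j^T\bar Hp_j\le\epsilon_H\|p_j\|^2$, return $(\mathrm{NC},p_j)$; (iv) if $\|r_j\|\ge\sqrt T(1-\tau)^{j/2}\|r_0\|$, compute $y_{j+1}$ and return $(\mathrm{NC},w)$ with $w=y_{j+1}-y_i$ for some $i<j$ such that $w^T\bar Hw/\|w\|^2\le\epsilon_H$. **Procedure 2 (minimum eigenvalue oracle)** is a randomized procedure that, for a symmetric $H$, returns either a unit vector $v$ with $v^THv\le-\epsilon_H/2$, or a certificate that $\lambda_{\min}(H)\ge-\epsilon_H$. Conditionally on everything that happened before the call, the probability that the certificate is issued although $\lambda_{\min}(H)<-\epsilon_H$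 is at most $\delta$. **Algorithm 2.** Iteration $k=0,1,\dots$ at $x_k$ uses an approximate gradient $g_k$ with accuracy $\delta_{g,k}$ and a symmetric approximate Hessian $H_k$ with $\|H_k\|\le U_H$; these may depend on the past of the run. - If $\|g_k\|\ge\epsilon_g$, call Procedure 1 with $H_k,g_k,\epsilon_H,\zeta,M=U_H$. If it returns $(\mathrm{NC},u)$, set $d_k=-\mathrm{sgn}(u^Tg_k)\frac{|u^TH_ku|}{\|u\|^2}\frac{u}{\|u\|}$. If it returns $(\mathrm{SOL},u)$, set $d_k=u$; if moreover $\|u\|\le\epsilon_g/\epsilon_H$, call Procedure 2 with $H_k$: on a certificate terminate and return $x_k+d_k$, otherwise replace $d_k$ by $-\mathrm{sgn}(v^Tg_k)|v^TH_kv|\,v$ and its type by $\mathrm{NC}$. - If $\|g_k\|<\epsilon_g$, call Procedure 2 with $H_k$: on a certificate terminate and return $x_k$, otherwise set $d_k=-\mathrm{sgn}(v^Tg_k)|v^TH_kv|\,v$, with type $\mathrm{NC}$. - If the algorithm has not terminated, set $x_{k+1}=x_k+\alpha_kd_k$, where for type $\mathrm{SOL}$ $$\alpha_k=\Big[\tfrac{3(1-\zeta)}{4(L_H+\eta)}\Big]^{1/2}\frac{\epsilon_H^{1/2}}{\|d_k\|^{1/2}},$$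 and for type $\mathrm{NC}$ $$\alpha_k=\tilde\theta\,\frac{\frac{\|d_k\|-\delta_H}{2}+\sqrt{\big(\frac{\|d_k\|-\delta_H}{2}\big)^2-\frac{4(L_H+\eta)\delta_{g,k}}{6}}}{(L_H+\eta)\|d_k\|/3}.$$ **Assumptions.** (a) On an open set that contains, for all runs and all iterations $k$, the segments $[x_k,x_k+d_k]$ and $[x_k,x_k+\alpha_kd_k]$ (just $x_k$ if the algorithm returns $x_k$), $\nabla f$ and $\nabla^2f$ are Lipschitz continuous with constants $L_g$ and $L_H$. (b) In every iteration $k$ that is executed, $\|g_k-\nabla f(x_k)\|\le\delta_{g,k}$ and $\|H_k-\nabla^2f(x_k)\|\le\delta_H$, with $$\delta_{g,k}\le\tfrac{1-\zeta}{8}\min\Big(\tfrac{3\epsilon_H^2}{65(L_H+\eta)},\ \max\big(\epsilon_g,\min(\epsilon_H\|d_k\|,\|g_k\|,\|g_{k+1}\|)\big)\Big),\qquad \delta_H\le\tfrac{1-\zeta}{4}\epsilon_H ;$$ in an iteration in which the algorithm terminates, the inner maximum is read as $\epsilon_g$. **Theorem.** Let $$\bar c_{\rm sol}=\frac\eta6\Big[\frac{3(1-\zeta)}{4L_H(L_H+\eta)}\Big]^{3/2},\quad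 \bar c_{\rm nc}=\frac\eta6\Big[\frac{3\tilde\theta}{4(L_H+\eta)}\Big]^3,\quad \bar K_2=2\left\lceil\frac{f(x_0)-f_{\rm low}}{\min\{\bar c_{\rm sol},\bar c_{\rm nc}/8\}\,L_H^{3/2}}\,\epsilon^{-3/2}\right\rceil+3 .$$ There are absolute constants $C_1,C_2>0$ such that, in every such setting, every call of Procedure 1 terminates, and Algorithm 2 terminates in at most $\bar K_2$ iterations at a point $x$ with $\|\nabla f(x)\|\le C_1\epsilon$. Moreover, with probability at least $(1-\delta)^{\bar K_2}$, this point also satisfies $\lambda_{\min}(\nabla^2f(x))\ge-C_2\sqrt{L_H\epsilon}$. -/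

import Mathlib

open MeasureTheory

noncomputable section

namespace InexactNewtonCG

/-! ### Vectors, matrices, derivatives -/

/-- `ℝ^d` with the Euclidean norm. -/
abbrev Vec (d : ℕ) : Type := EuclideanSpace ℝ (Fin d)

/-- `d × d` real matrices, as linear operators of `ℝ^d`; the norm is the spectral norm. -/
abbrev Mat (d : ℕ) : Type := Vec d →L[ℝ] Vec d

/-- The Hessian `∇²f(x)`: the derivative of the gradient. -/
def hessian {d : ℕ} (f : Vec d → ℝ) (x : Vec d) : Mat d := fderiv ℝ (gradient f) x

/-- The smallest eigenvalue of a symmetric matrix. -/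
def lambdaMin {d : ℕ} (A : Mat d) : ℝ :=
  sInf {t : ℝ | Module.End.HasEigenvalue (A : Vec d →ₗ[ℝ] Vec d) t}

/-- `s` is a sign of `t`: `s = 1` if `t > 0`, `s = -1` if `t < 0`, and either of the two if
`t = 0` (a sign `0` would produce a zero search direction). -/
def IsSgn (s t : ℝ) : Prop := (s = 1 ∨ s = -1) ∧ s * t = |t|

/-! ### The capped conjugate gradient procedure -/

/-- The type of a direction: approximate solution of the damped Newton system, or direction of
negative curvature. -/
inductive DirType : Type
  | SOL : DirType
  | NC : DirType

namespace CappedCG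

/-- `κ = (M + 2ε) / ε`. -/
def kappa (M ε : ℝ) : ℝ := (M + 2 * ε) / ε

/-- The relative accuracy `ζ / (3κ)` of the residual test. -/
def zetaHat (M ε ζ : ℝ) : ℝ := ζ / (3 * kappa M ε)

/-- `τ = 1 / (√κ + 1)`. -/
def tau (M ε : ℝ) : ℝ := 1 / (√(kappa M ε) + 1)

/-- `T = 4κ⁴ / (1 - √(1 - τ))²`. -/
def capT (M ε : ℝ) : ℝ := 4 * kappa M ε ^ 4 / (1 - √(1 - tau M ε)) ^ 2

/-- The damped matrix `H + 2εI`. -/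
def damped {d : ℕ} (H : Mat d) (ε : ℝ) : Mat d := H + (2 * ε) • ContinuousLinearMap.id ℝ (Vec d)

/-- The variables of the procedure: CG iterate, residual, CG direction, and the current bound `M`
on the norm of `H`. -/
structure State (d : ℕ) where
  y : Vec d
  r : Vec d
  p : Vec d
  M : ℝ

/-- The state when the main loop is entered (`j = 0`); `M` may have been enlarged. -/
def init {d : ℕ} (H : Mat d) (g : Vec d) (M : ℝ) : State d where
  y := 0
  r := g
  p := -g
  M := if ‖H (-g)‖ > M * ‖(-g : Vec d)‖ then ‖H (-g)‖ / ‖(-g : Vec d)‖ else M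

/-- One pass of the standard CG recursion, followed by the update of `M`. -/
def next {d : ℕ} (H : Mat d) (ε : ℝ) (s : State d) : State d :=
  let α : ℝ := inner ℝ s.r s.r / inner ℝ s.p (damped H ε s.p)
  let y : Vec d := s.y + α • s.p
  let r : Vec d := s.r + α • damped H ε s.p
  let β : ℝ := inner ℝ r r / inner ℝ s.r s.r
  let p : Vec d := -r + β • s.p
  let m : ℝ := max (‖H p‖ / ‖p‖) (max (‖H y‖ / ‖y‖) (‖H r‖ / ‖r‖))
  { y := y, r := r, p := p, M := if m > s.M then m else s.M }

/-- The state after `j` CG passes. -/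
def state {d : ℕ} (H : Mat d) (g : Vec d) (ε M : ℝ) : ℕ → State d
  | 0 => init H g M
  | j + 1 => next H ε (state H g ε M j)

/-- Negative curvature test at the very start. -/
def InitialTest {d : ℕ} (H : Mat d) (g : Vec d) (ε : ℝ) : Prop :=
  inner ℝ (-g) (damped H ε (-g)) < ε * ‖(-g : Vec d)‖ ^ 2

/-- Negative curvature along the CG iterate `y`. -/
def TestY {d : ℕ} (H : Mat d) (ε : ℝ) (s : State d) : Prop :=
  inner ℝ s.y (damped H ε s.y) ≤ ε * ‖s.y‖ ^ 2

/-- The residual is small enough (`r₀ = g`). -/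
def TestSol {d : ℕ} (g : Vec d) (ε ζ : ℝ) (s : State d) : Prop :=
  ‖s.r‖ ≤ zetaHat s.M ε ζ * ‖g‖

/-- Negative curvature along the CG direction `p`. -/
def TestP {d : ℕ} (H : Mat d) (ε : ℝ) (s : State d) : Prop :=
  inner ℝ s.p (damped H ε s.p) ≤ ε * ‖s.p‖ ^ 2

/-- The residual decays too slowly after `j` passes (`r₀ = g`). -/
def TestSlow {d : ℕ} (g : Vec d) (ε : ℝ) (j : ℕ) (s : State d) : Prop :=
  ‖s.r‖ ≥ √(capT s.M ε) * (1 - tau s.M ε) ^ ((j : ℝ) / 2) * ‖g‖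

/-- The tests after the `j`-th CG pass are carried out: `j ≥ 1` and none of the earlier tests was
satisfied. -/
def Reaches {d : ℕ} (H : Mat d) (g : Vec d) (ε ζ M : ℝ) (j : ℕ) : Prop :=
  1 ≤ j ∧ ¬ InitialTest H g ε ∧ ∀ i : ℕ, 1 ≤ i → i < j →
    ¬ TestY H ε (state H g ε M i) ∧ ¬ TestSol g ε ζ (state H g ε M i) ∧
    ¬ TestP H ε (state H g ε M i) ∧ ¬ TestSlow g ε i (state H g ε M i)

/-- `Returns H g ε ζ M t d`: the procedure, called with matrix `H`, vector `g`, damping parameter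
`ε`, accuracy `ζ` and initial bound `M`, terminates and may return the type `t` and the vector `d`.
(In the last case the index `i` may be any one that qualifies.) -/
inductive Returns {d : ℕ} (H : Mat d) (g : Vec d) (ε ζ M : ℝ) : DirType → Vec d → Prop
  | initial : InitialTest H g ε → Returns H g ε ζ M DirType.NC (-g)
  | curvY (j : ℕ) : Reaches H g ε ζ M j →
      TestY H ε (state H g ε M j) →
      Returns H g ε ζ M DirType.NC (state H g ε M j).y
  | sol (j : ℕ) : Reaches H g ε ζ M j →
      ¬ TestY H ε (state H g ε M j) →
      TestSol g ε ζ (state H g ε M j) →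
      Returns H g ε ζ M DirType.SOL (state H g ε M j).y
  | curvP (j : ℕ) : Reaches H g ε ζ M j →
      ¬ TestY H ε (state H g ε M j) →
      ¬ TestSol g ε ζ (state H g ε M j) →
      TestP H ε (state H g ε M j) →
      Returns H g ε ζ M DirType.NC (state H g ε M j).p
  | slow (j : ℕ) (i : ℕ) (w : Vec d) : Reaches H g ε ζ M j →
      ¬ TestY H ε (state H g ε M j) →
      ¬ TestSol g ε ζ (state H g ε M j) →
      ¬ TestP H ε (state H g ε M j) →
      TestSlow g ε j (state H g ε M j) →
      i < j →
      w = (state H g ε M (j + 1)).y - (state H g ε M i).y →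
      w ≠ 0 →
      inner ℝ w (damped H ε w) / ‖w‖ ^ 2 ≤ ε →
      Returns H g ε ζ M DirType.NC w

end CappedCG

/-! ### The Newton-CG method with predefined step sizes -/

/-- The parameters of the method. -/
structure Params where
  /-- gradient tolerance `ε_g` -/
  εg : ℝ
  /-- Hessian tolerance `ε_H` -/
  εH : ℝ
  /-- accuracy `ζ` of the capped CG procedure -/
  ζ : ℝ
  /-- bound `U_H` on the norm of the approximate Hessians -/
  UH : ℝ
  /-- Lipschitz constant `L_H` of the Hessian -/
  LH : ℝ
  /-- decrease parameter `η` -/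
  η : ℝ
  /-- factor `θ̃` of the negative curvature step size -/
  θt : ℝ
  /-- accuracy `δ_H` of the approximate Hessians -/
  δH : ℝ
  /-- failure probability `δ` of the minimum eigenvalue oracle -/
  δ : ℝ

/-- The admissible parameters. -/
structure Params.Valid (P : Params) : Prop where
  εg_pos : 0 < P.εg
  εH_pos : 0 < P.εH
  UH_pos : 0 < P.UH
  ζ_pos : 0 < P.ζ
  ζ_lt : P.ζ < min 1 P.UH
  LH_pos : 0 < P.LH
  η_pos : 0 < P.η
  θt_gt : (2 - √3) ^ 2 < P.θt
  θt_lt : P.θt < 1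
  δ_nonneg : 0 ≤ P.δ
  δ_lt : P.δ < 1

/-- The predefined step size for a direction of the given type with norm `nd`, where `δg` is the
current gradient accuracy. -/
def stepSize (P : Params) (δg : ℝ) (nd : ℝ) : DirType → ℝ
  | DirType.SOL => (3 * (1 - P.ζ) / (4 * (P.LH + P.η))) ^ (1 / 2 : ℝ) *
      (P.εH ^ (1 / 2 : ℝ) / nd ^ (1 / 2 : ℝ))
  | DirType.NC =>
      (((nd - P.δH) / 2 + √(((nd - P.δH) / 2) ^ 2 - 4 * (P.LH + P.η) * δg / 6)) /
        ((P.LH + P.η) * nd / 3)) * P.θt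

/-- The outcome of the direction-finding part of an iteration: return the point `z` (with `u` the
last computed direction, `0` if there is none), or take a step along `u`. -/
inductive Outcome (d : ℕ) : Type
  | halt (z u : Vec d) : Outcome d
  | step (t : DirType) (u : Vec d) : Outcome d

/-- The minimum eigenvalue oracle is called in the current iteration; `t`, `u` is the result of the
capped CG call (if there was one). -/
def CallsOracle (P : Params) {d : ℕ} (g : Vec d) (t : DirType) (u : Vec d) : Prop :=
  ‖g‖ < P.εg ∨ (P.εg ≤ ‖g‖ ∧ t = DirType.SOL ∧ ‖u‖ ≤ P.εg / P.εH)

/-- The direction-finding part of an iteration at `x` with approximate gradient `g` and approximate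
Hessian `H`. The result of the capped CG call is `t`, `u` (relevant only if `‖g‖ ≥ ε_g`), the answer
of the minimum eigenvalue oracle is `a` (relevant only if it is called): `none` is the certificate
`λ_min(H) ≥ -ε_H`, and `some v` is a direction of negative curvature. -/
inductive Iteration (P : Params) {d : ℕ} (x g : Vec d) (H : Mat d) (t : DirType) (u : Vec d)
    (a : Option (Vec d)) : Outcome d → Prop
  | cgNC (s : ℝ) : P.εg ≤ ‖g‖ → t = DirType.NC → IsSgn s (inner ℝ u g) →
      Iteration P x g H t u a
        (Outcome.step DirType.NC (-((s * (|inner ℝ u (H u)| / ‖u‖ ^ 2)) • (‖u‖⁻¹ • u))))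
  | cgSol : P.εg ≤ ‖g‖ → t = DirType.SOL → P.εg / P.εH < ‖u‖ →
      Iteration P x g H t u a (Outcome.step DirType.SOL u)
  | smallSolStop : P.εg ≤ ‖g‖ → t = DirType.SOL → ‖u‖ ≤ P.εg / P.εH → a = none →
      Iteration P x g H t u a (Outcome.halt (x + u) u)
  | smallSolNC (v : Vec d) (s : ℝ) : P.εg ≤ ‖g‖ → t = DirType.SOL → ‖u‖ ≤ P.εg / P.εH →
      a = some v → IsSgn s (inner ℝ v g) →
      Iteration P x g H t u a
        (Outcome.step DirType.NC (-((s * |inner ℝ v (H v)|) • v)))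
  | smallGradStop : ‖g‖ < P.εg → a = none →
      Iteration P x g H t u a (Outcome.halt x 0)
  | smallGradNC (v : Vec d) (s : ℝ) : ‖g‖ < P.εg →
      a = some v → IsSgn s (inner ℝ v g) →
      Iteration P x g H t u a
        (Outcome.step DirType.NC (-((s * |inner ℝ v (H v)|) • v)))

/-- The random quantities that occur in a run of the method. The values of `g`, `H`, `δg`, `cgType`,
`cgDir`, `oracle`, `dir` at index `k` matter only if the run has not stopped before iteration `k`. -/
structure Trace (Ω : Type*) (d : ℕ) where
  /-- the method has terminated before iteration `k` -/
  stopped : ℕ → Ω → Prop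
  /-- the iterate `x_k` as long as the run goes on, the returned point afterwards -/
  x : ℕ → Ω → Vec d
  /-- approximate gradient -/
  g : ℕ → Ω → Vec d
  /-- approximate Hessian -/
  H : ℕ → Ω → Mat d
  /-- accuracy of the approximate gradient -/
  δg : ℕ → Ω → ℝ
  /-- type returned by the capped CG call -/
  cgType : ℕ → Ω → DirType
  /-- vector returned by the capped CG call -/
  cgDir : ℕ → Ω → Vec d
  /-- answer of the minimum eigenvalue oracle -/
  oracle : ℕ → Ω → Option (Vec d)
  /-- the search direction `d_k`, as it is when the step is taken or termination is declared -/
  dir : ℕ → Ω → Vec d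

/-- The trace `R` is a run of the method with parameters `P`, started at `x₀`, on the probability
space `(Ω, μ)`. The σ-algebra `ℱ k` is the information available when the minimum eigenvalue oracle
may be called in iteration `k`. -/
structure IsRun (P : Params) {d : ℕ} (x₀ : Vec d) {Ω : Type*} [mΩ : MeasurableSpace Ω]
    (μ : Measure Ω) (ℱ : Filtration ℕ mΩ) (R : Trace Ω d) : Prop where
  measurable_stopped : ∀ k, MeasurableSet[ℱ k] {ω | R.stopped k ω}
  measurable_x : ∀ k, Measurable[ℱ k] (R.x k)
  measurable_g : ∀ k, Measurable[ℱ k] (R.g k)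
  measurable_H : ∀ k, Measurable[ℱ k] (R.H k)
  measurable_δg : ∀ k, Measurable[ℱ k] (R.δg k)
  measurable_cgType : ∀ k, MeasurableSet[ℱ k] {ω | R.cgType k ω = DirType.SOL}
  measurable_cgDir : ∀ k, Measurable[ℱ k] (R.cgDir k)
  measurable_certificate : ∀ k, MeasurableSet[ℱ (k + 1)] {ω | R.oracle k ω = none}
  start : ∀ ω, ¬ R.stopped 0 ω ∧ R.x 0 ω = x₀
  /-- the approximate Hessians are symmetric and bounded by the input `U_H` -/
  hessians : ∀ k ω, ¬ R.stopped k ω →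
    (R.H k ω : Vec d →ₗ[ℝ] Vec d).IsSymmetric ∧ ‖R.H k ω‖ ≤ P.UH
  /-- the result of the capped CG call, provided that the call terminates -/
  cg_call : ∀ k ω, ¬ R.stopped k ω → P.εg ≤ ‖R.g k ω‖ →
    (∃ t u, CappedCG.Returns (R.H k ω) (R.g k ω) P.εH P.ζ P.UH t u) →
    CappedCG.Returns (R.H k ω) (R.g k ω) P.εH P.ζ P.UH (R.cgType k ω) (R.cgDir k ω)
  /-- a direction returned by the oracle is a unit vector of sufficient negative curvature -/
  oracle_direction : ∀ k ω, ¬ R.stopped k ω → CallsOracle P (R.g k ω) (R.cgType k ω) (R.cgDir k ω) →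
    ∀ v, R.oracle k ω = some v → ‖v‖ = 1 ∧ inner ℝ v (R.H k ω v) ≤ -P.εH / 2
  /-- given the past, the oracle issues a wrong certificate with probability at most `δ` -/
  oracle_failure : ∀ k (A : Set Ω), MeasurableSet[ℱ k] A →
    (∀ ω ∈ A, ¬ R.stopped k ω ∧ CallsOracle P (R.g k ω) (R.cgType k ω) (R.cgDir k ω) ∧
      lambdaMin (R.H k ω) < -P.εH) →
    μ (A ∩ {ω | R.oracle k ω = none}) ≤ ENNReal.ofReal P.δ * μ A
  /-- one iteration -/
  iteration : ∀ k ω, ¬ R.stopped k ω → ∃ o : Outcome d,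
    Iteration P (R.x k ω) (R.g k ω) (R.H k ω) (R.cgType k ω) (R.cgDir k ω) (R.oracle k ω) o ∧
    match o with
    | Outcome.halt z u => R.dir k ω = u ∧ R.stopped (k + 1) ω ∧ R.x (k + 1) ω = z
    | Outcome.step t u => R.dir k ω = u ∧ ¬ R.stopped (k + 1) ω ∧
        R.x (k + 1) ω = R.x k ω + stepSize P (R.δg k ω) ‖u‖ t • u
  /-- nothing changes after termination -/
  after : ∀ k ω, R.stopped k ω → R.stopped (k + 1) ω ∧ R.x (k + 1) ω = R.x k ω

/-- The standing assumption on the objective function: it is `C²`, bounded below by `flow`, has a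
compact sub-level set at `x₀`, and its gradient and Hessian are Lipschitz continuous on an open set
that contains the segments `[x_k, x_k + d_k]` and `[x_k, x_{k+1}]` of the run. -/
structure SmoothnessAssumption {d : ℕ} (f : Vec d → ℝ) (x₀ : Vec d) (flow Lg LH : ℝ)
    {Ω : Type*} (R : Trace Ω d) : Prop where
  contDiff : ContDiff ℝ 2 f
  bounded_below : ∀ x, flow ≤ f x
  compact_sublevel : IsCompact {x | f x ≤ f x₀}
  Lg_pos : 0 < Lg
  LH_pos : 0 < LH
  lipschitz : ∃ B : Set (Vec d), IsOpen B ∧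
    (∀ k ω, ¬ R.stopped k ω →
      segment ℝ (R.x k ω) (R.x k ω + R.dir k ω) ⊆ B ∧
      segment ℝ (R.x k ω) (R.x (k + 1) ω) ⊆ B) ∧
    (∀ x ∈ B, ∀ y ∈ B, ‖gradient f x - gradient f y‖ ≤ Lg * ‖x - y‖) ∧
    (∀ x ∈ B, ∀ y ∈ B, ‖hessian f x - hessian f y‖ ≤ LH * ‖x - y‖)

/-- The accuracy required of the approximate gradients and Hessians. In an iteration in which the
method terminates, the inner maximum is `ε_g`, whatever `d_k` and `g_{k+1}` may be. -/
structure InexactnessCondition (P : Params) {d : ℕ} (f : Vec d → ℝ) {Ω : Type*}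
    (R : Trace Ω d) : Prop where
  gradient_accuracy : ∀ k ω, ¬ R.stopped k ω → ‖R.g k ω - gradient f (R.x k ω)‖ ≤ R.δg k ω
  hessian_accuracy : ∀ k ω, ¬ R.stopped k ω → ‖R.H k ω - hessian f (R.x k ω)‖ ≤ P.δH
  δg_le : ∀ k ω, ¬ R.stopped k ω → R.δg k ω ≤ (1 - P.ζ) / 8 *
    min (3 * P.εH ^ 2 / (65 * (P.LH + P.η)))
      (max P.εg (min (P.εH * ‖R.dir k ω‖) (min ‖R.g k ω‖ ‖R.g (k + 1) ω‖)))
  δH_le : P.δH ≤ (1 - P.ζ) / 4 * P.εH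

/-! ### The iteration bound -/

/-- `c̄_sol`. -/
def cSol (P : Params) : ℝ :=
  P.η / 6 * (3 * (1 - P.ζ) / (4 * P.LH * (P.LH + P.η))) ^ (3 / 2 : ℝ)

/-- `c̄_nc`. -/
def cNC (P : Params) : ℝ := P.η / 6 * (3 * P.θt / (4 * (P.LH + P.η))) ^ 3

/-- The iteration bound `K̄₂`, with `Δ = f(x₀) - f_low` (which is nonnegative). -/
def iterationBound (P : Params) (Δ ε : ℝ) : ℕ :=
  2 * ⌈Δ / (min (cSol P) (cNC P / 8) * P.LH ^ (3 / 2 : ℝ)) * ε ^ (-(3 / 2) : ℝ)⌉₊ + 3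

end InexactNewtonCG

end

noncomputable section

namespace InexactNewtonCG

/-! ### Conjugate gradients: orthogonality relations -/

namespace CappedCG

variable {d : ℕ} {H : Mat d} {g : Vec d} {ε M ζ : ℝ}

/-! Two facts carry the proof. Every iteration that takes a step lowers `f` by a fixed multiple of
ε^(3/2), and every halt occurs at a certified matrix, with a last direction of length at most
ε_g/ε_H.

Decrease: insert the step into the cubic Taylor model with inexact derivatives
(`inexact_taylor_le`). For type NC one has uᵀHu = -‖u‖³, gᵀu ≤ 0 and ‖u‖ ≥ ε_H/2. In s = α‖u‖ the
bound on the change of `f` is then s times a quadratic, minus ηs³/6, and the step size puts s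
between the roots of that quadratic (`nc_step_bounds`, `nc_decrease`). For type SOL, CG
orthogonality gives gᵀu = -uᵀH̄u, and the curvature of H̄ along u absorbs all errors
(`sol_decrease`). Such steps are taken only if ‖u‖ > ε_g/ε_H, so their decrease has the same order.
A step at a small gradient is an oracle step of type NC. Hence no iteration is exceptional, and the
lower bound on `f` limits their number.

Returned point: the CG residual is bounded by ε_H‖u‖ instead of ‖g‖ (`residual_le`). Since ε_H‖u‖ ≤
ε at a halt, each contribution to the new gradient is an absolute multiple of ε. The Hessian moves
by at most L_H‖u‖ ≤ ε_H, so a correct certificate survives the last step. The conditional failure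
bound makes all certificates correct with probability at least (1-δ)^n (`pow_le_measure_reliable`).

Capped CG: nonzero residuals are orthogonal, so there are finitely many passes. It remains to see
that slow decay yields an admissible index i. If the curvature along every y_{j+1} - y_i were at
least ε_H, an estimate sequence (`exists_estimate`) would force ‖r_j‖² ≤ 2κ(1-τ)^j‖g‖², which
contradicts the slow decay test because T > 2κ. -/

theorem damped_apply (H : Mat d) (ε : ℝ) (v : Vec d) :
    damped H ε v = H v + (2 * ε) • v := by
  simp [damped]

theorem inner_damped_self (H : Mat d) (ε : ℝ) (v : Vec d) :
    inner ℝ v (damped H ε v) = inner ℝ v (H v) + 2 * ε * ‖v‖ ^ 2 := by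
  rw [damped_apply, inner_add_right, real_inner_smul_right, real_inner_self_eq_norm_sq]

theorem inner_damped_comm (hH : (H : Vec d →ₗ[ℝ] Vec d).IsSymmetric) (u v : Vec d) :
    inner ℝ (damped H ε u) v = inner ℝ u (damped H ε v) := by
  have h : inner ℝ (H u) v = inner ℝ u (H v) := hH u v
  simp only [damped_apply, inner_add_left, inner_add_right, real_inner_smul_left,
    real_inner_smul_right, h]

theorem inner_damped_self_le (hM : ‖H‖ ≤ M) (v : Vec d) :
    inner ℝ v (damped H ε v) ≤ (M + 2 * ε) * ‖v‖ ^ 2 := by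
  have h1 : inner ℝ v (H v) ≤ ‖v‖ * ‖H v‖ := real_inner_le_norm v (H v)
  have h2 : ‖H v‖ ≤ M * ‖v‖ := H.le_of_opNorm_le hM v
  rw [inner_damped_self]
  nlinarith [norm_nonneg v]

/-- The step length of the CG recursion. -/
def stepLength (H : Mat d) (ε : ℝ) (s : State d) : ℝ :=
  inner ℝ s.r s.r / inner ℝ s.p (damped H ε s.p)

theorem state_succ_y (j : ℕ) : (state H g ε M (j + 1)).y =
    (state H g ε M j).y + stepLength H ε (state H g ε M j) • (state H g ε M j).p := rfl

theorem state_succ_r (j : ℕ) : (state H g ε M (j + 1)).r =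
    (state H g ε M j).r +
      stepLength H ε (state H g ε M j) • damped H ε (state H g ε M j).p := rfl

theorem state_succ_p (j : ℕ) : (state H g ε M (j + 1)).p =
    -(state H g ε M (j + 1)).r +
      (inner ℝ (state H g ε M (j + 1)).r (state H g ε M (j + 1)).r /
        inner ℝ (state H g ε M j).r (state H g ε M j).r) • (state H g ε M j).p := rfl

theorem norm_div_norm_le (hM : ‖H‖ ≤ M) (v : Vec d) : ‖H v‖ / ‖v‖ ≤ M :=
  (H.ratio_le_opNorm v).trans hM

/-- All ratios compared with `M` are at most ‖H‖, so `M` is never enlarged and κ, τ, T stay fixed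
during a call. -/
theorem state_M (hM : ‖H‖ ≤ M) (j : ℕ) : (state H g ε M j).M = M := by
  induction j with
  | zero =>
    have h := H.le_of_opNorm_le hM (-g)
    simp only [state, init]
    rw [if_neg (not_lt.mpr h)]
  | succ j ih =>
    change (next H ε (state H g ε M j)).M = M
    simp only [next]
    rw [if_neg, ih]
    rw [ih]
    exact not_lt.mpr (max_le (norm_div_norm_le hM _)
      (max_le (norm_div_norm_le hM _) (norm_div_norm_le hM _)))

/-- The first `n` passes of the CG recursion do not break down. -/
def Regular (H : Mat d) (g : Vec d) (ε M : ℝ) (n : ℕ) : Prop :=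
  ∀ i < n, (state H g ε M i).r ≠ 0 ∧
    0 < inner ℝ (state H g ε M i).p (damped H ε (state H g ε M i).p)

theorem Regular.mono {m n : ℕ} (h : Regular H g ε M n) (hmn : m ≤ n) : Regular H g ε M m :=
  fun i hi => h i (hi.trans_le hmn)

theorem Regular.stepLength_pos {n i : ℕ} (h : Regular H g ε M n) (hi : i < n) :
    0 < stepLength H ε (state H g ε M i) :=
  div_pos (real_inner_self_pos.mpr (h i hi).1) (h i hi).2

theorem Regular.stepLength_mul {n i : ℕ} (h : Regular H g ε M n) (hi : i < n) :
    stepLength H ε (state H g ε M i) *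
      inner ℝ (state H g ε M i).p (damped H ε (state H g ε M i).p) =
      ‖(state H g ε M i).r‖ ^ 2 := by
  rw [stepLength, div_mul_cancel₀ _ (h i hi).2.ne', real_inner_self_eq_norm_sq]

/-- The orthogonality relations of the conjugate gradient method. -/
structure Conjugacy (H : Mat d) (g : Vec d) (ε M : ℝ) (n : ℕ) : Prop where
  r_r : ∀ i < n, inner ℝ (state H g ε M n).r (state H g ε M i).r = 0
  r_p : ∀ i < n, inner ℝ (state H g ε M n).r (state H g ε M i).p = 0
  p_p : ∀ i < n, inner ℝ (state H g ε M n).p (damped H ε (state H g ε M i).p) = 0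
  self : inner ℝ (state H g ε M n).r (state H g ε M n).p = -‖(state H g ε M n).r‖ ^ 2

theorem conjugacy (hH : (H : Vec d →ₗ[ℝ] Vec d).IsSymmetric) (n : ℕ)
    (hn : Regular H g ε M n) : Conjugacy H g ε M n := by
  induction n with
  | zero =>
    refine ⟨by simp, by simp, by simp, ?_⟩
    simp [state, init, inner_neg_right]
  | succ n ih =>
    have hc := ih (hn.mono n.le_succ)
    have hrp : ∀ i < n + 1, inner ℝ (state H g ε M (n + 1)).r (state H g ε M i).p = 0 := by
      intro i hi
      rw [state_succ_r, inner_add_left, real_inner_smul_left, inner_damped_comm hH]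
      rcases Nat.lt_succ_iff_lt_or_eq.mp hi with h | rfl
      · rw [hc.r_p i h, hc.p_p i h, mul_zero, add_zero]
      · rw [hc.self, hn.stepLength_mul hi]
        ring
    have hrr : ∀ i < n + 1, inner ℝ (state H g ε M (n + 1)).r (state H g ε M i).r = 0 := by
      intro i hi
      -- Each residual is a combination of CG directions: r₀ = -p₀, and r_{i+1} combines p_{i+1} and
      -- p_i.
      cases i with
      | zero =>
        have := hrp 0 hi
        simpa [state, init, inner_neg_right] using this
      | succ i =>
        have h1 := hrp (i + 1) hi
        rw [state_succ_p i, inner_add_right, real_inner_smul_right, hrp i (by omega),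
          inner_neg_right] at h1
        linarith
    refine ⟨hrr, hrp, ?_, ?_⟩
    · intro i hi
      have hα := hn.stepLength_pos hi
      -- The vector α_i H̄p_i is the residual difference r_{i+1} - r_i, so conjugacy reduces to
      -- orthogonality of residuals; α_i > 0 is cancelled at the end.
      have key : stepLength H ε (state H g ε M i) *
          inner ℝ (state H g ε M (n + 1)).p (damped H ε (state H g ε M i).p) = 0 := by
        have e : stepLength H ε (state H g ε M i) • damped H ε (state H g ε M i).p =
            (state H g ε M (i + 1)).r - (state H g ε M i).r := by
          rw [state_succ_r]; abel
        rw [state_succ_p n, inner_add_left, inner_neg_left, real_inner_smul_left, mul_add,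
          mul_neg, ← real_inner_smul_right, e, inner_sub_right, hrr i hi]
        rcases Nat.lt_succ_iff_lt_or_eq.mp hi with h | rfl
        · rw [hrr (i + 1) (by omega), hc.p_p i h]
          ring
        · have hr : inner ℝ (state H g ε M i).r (state H g ε M i).r ≠ 0 :=
            (real_inner_self_pos.mpr (hn i hi).1).ne'
          have h2 := hn.stepLength_mul hi
          rw [← real_inner_self_eq_norm_sq] at h2
          rw [mul_left_comm, h2, div_mul_cancel₀ _ hr]
          ring
      exact (mul_eq_zero.mp key).resolve_left hα.ne'
    · rw [state_succ_p n, inner_add_right, inner_neg_right, real_inner_smul_right,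
        hrp n n.lt_succ_self, real_inner_self_eq_norm_sq]
      ring

theorem state_r (j : ℕ) :
    (state H g ε M j).r = g + damped H ε (state H g ε M j).y := by
  induction j with
  | zero => simp [state, init]
  | succ j ih => rw [state_succ_r, state_succ_y, ih, map_add, map_smul, add_assoc]

/-- y_n is a combination of p_0, …, p_{n-1}, all orthogonal to r_m when n ≤ m. -/
theorem inner_r_y (hH : (H : Vec d →ₗ[ℝ] Vec d).IsSymmetric) {m : ℕ}
    (hm : Regular H g ε M m) (n : ℕ) (hn : n ≤ m) :
    inner ℝ (state H g ε M m).r (state H g ε M n).y = 0 := by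
  induction n with
  | zero => simp [state, init]
  | succ n ih =>
    rw [state_succ_y, inner_add_right, real_inner_smul_right, ih (by omega),
      (conjugacy hH m hm).r_p n (by omega)]
    ring

theorem inner_damped_y (hH : (H : Vec d →ₗ[ℝ] Vec d).IsSymmetric) {n : ℕ}
    (hn : Regular H g ε M n) :
    inner ℝ (state H g ε M n).y (damped H ε (state H g ε M n).y) =
      -inner ℝ g (state H g ε M n).y := by
  have h := inner_r_y hH hn n le_rfl
  rw [state_r, inner_add_left, real_inner_comm] at h
  rw [real_inner_comm] at h
  have := real_inner_comm (state H g ε M n).y (damped H ε (state H g ε M n).y)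
  linarith

/-- By conjugacy only the term α_0 p_0 of y_{n+1} contributes. The value is positive, which is how
`y_ne_zero` excludes a zero iterate. -/
theorem inner_y_first (hH : (H : Vec d →ₗ[ℝ] Vec d).IsSymmetric) (n : ℕ)
    (hn : Regular H g ε M (n + 1)) :
    inner ℝ (state H g ε M (n + 1)).y (damped H ε (state H g ε M 0).p) =
      ‖(state H g ε M 0).r‖ ^ 2 := by
  induction n with
  | zero =>
    rw [state_succ_y, inner_add_left, real_inner_smul_left, hn.stepLength_mul zero_lt_one]
    simp [state, init]
  | succ n ih =>
    rw [state_succ_y, inner_add_left, real_inner_smul_left, ih (hn.mono (by omega)),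
      (conjugacy hH (n + 1) (hn.mono (by omega))).p_p 0 (by omega)]
    ring

theorem y_ne_zero (hH : (H : Vec d →ₗ[ℝ] Vec d).IsSymmetric) {n : ℕ} (h1 : 1 ≤ n)
    (hn : Regular H g ε M n) : (state H g ε M n).y ≠ 0 := by
  obtain ⟨n, rfl⟩ := Nat.exists_eq_add_of_le' h1
  intro h
  have := inner_y_first hH n hn
  rw [h, inner_zero_left] at this
  exact (hn 0 (by omega)).1 (norm_eq_zero.mp (pow_eq_zero_iff two_ne_zero |>.mp this.symm))

theorem p_ne_zero (hH : (H : Vec d →ₗ[ℝ] Vec d).IsSymmetric) {n : ℕ}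
    (hn : Regular H g ε M n) (hr : (state H g ε M n).r ≠ 0) : (state H g ε M n).p ≠ 0 := by
  intro h
  have := (conjugacy hH n hn).self
  rw [h, inner_zero_right, eq_comm, neg_eq_zero] at this
  exact hr (norm_eq_zero.mp (pow_eq_zero_iff two_ne_zero |>.mp this))

/-- The curvature along a CG direction does not exceed the curvature along the residual. -/
theorem inner_p_le (hH : (H : Vec d →ₗ[ℝ] Vec d).IsSymmetric) (hM : ‖H‖ ≤ M) {n : ℕ}
    (hn : Regular H g ε M n) :
    inner ℝ (state H g ε M n).p (damped H ε (state H g ε M n).p) ≤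
      (M + 2 * ε) * ‖(state H g ε M n).r‖ ^ 2 := by
  refine le_trans ?_ (inner_damped_self_le hM _)
  cases n with
  | zero => simp [state, init]
  | succ n =>
    have hc := (conjugacy hH (n + 1) hn).p_p n n.lt_succ_self
    set b := inner ℝ (state H g ε M (n + 1)).r (state H g ε M (n + 1)).r /
        inner ℝ (state H g ε M n).r (state H g ε M n).r with hb
    -- The two terms are conjugate, so the curvature of r_{n+1} is that of p_{n+1} plus b² times
    -- that of p_n.
    have e : (state H g ε M (n + 1)).r =
        b • (state H g ε M n).p - (state H g ε M (n + 1)).p := by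
      rw [state_succ_p n]; abel
    have hp := (hn n n.lt_succ_self).2
    have hc' : inner ℝ (state H g ε M n).p (damped H ε (state H g ε M (n + 1)).p) = 0 := by
      rw [← inner_damped_comm hH, real_inner_comm]; exact hc
    rw [e]
    simp only [map_sub, map_smul, inner_sub_left, inner_sub_right, real_inner_smul_left,
      real_inner_smul_right, hc, hc']
    nlinarith [mul_nonneg (mul_self_nonneg b) hp.le]

/-! ### The accelerated rate of conjugate gradients -/

/-- The quadratic function that the CG recursion minimizes. -/
def quad (H : Mat d) (g : Vec d) (ε : ℝ) (y : Vec d) : ℝ :=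
  inner ℝ y (damped H ε y) / 2 + inner ℝ g y

theorem quad_expand (hH : (H : Vec d →ₗ[ℝ] Vec d).IsSymmetric) (n : ℕ) (w : Vec d) :
    quad H g ε w = quad H g ε (state H g ε M n).y +
      inner ℝ (state H g ε M n).r (w - (state H g ε M n).y) +
      inner ℝ (w - (state H g ε M n).y) (damped H ε (w - (state H g ε M n).y)) / 2 := by
  rw [state_r]
  set y := (state H g ε M n).y
  have h : inner ℝ w (damped H ε y) = inner ℝ y (damped H ε w) := by
    rw [← inner_damped_comm hH, real_inner_comm]
  simp only [quad, map_sub, inner_sub_left, inner_sub_right, inner_add_left,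
    inner_damped_comm hH]
  rw [h]
  ring

theorem quad_succ (hH : (H : Vec d →ₗ[ℝ] Vec d).IsSymmetric) {n : ℕ}
    (hn : Regular H g ε M (n + 1)) :
    quad H g ε (state H g ε M (n + 1)).y = quad H g ε (state H g ε M n).y -
      stepLength H ε (state H g ε M n) * ‖(state H g ε M n).r‖ ^ 2 / 2 := by
  rw [quad_expand (M := M) hH n, state_succ_y, add_sub_cancel_left, map_smul,
    real_inner_smul_left, real_inner_smul_right, real_inner_smul_right,
    (conjugacy hH n (hn.mono n.le_succ)).self, hn.stepLength_mul n.lt_succ_self]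
  ring

/-- By `inner_p_le` the CG step length is at least 1/(M+2ε), which gives the classical guarantee of
a gradient step of that length. -/
theorem quad_succ_le (hH : (H : Vec d →ₗ[ℝ] Vec d).IsSymmetric) (hM : ‖H‖ ≤ M) (hε : 0 < ε)
    {n : ℕ} (hn : Regular H g ε M (n + 1)) :
    quad H g ε (state H g ε M (n + 1)).y ≤ quad H g ε (state H g ε M n).y -
      ‖(state H g ε M n).r‖ ^ 2 / (2 * (M + 2 * ε)) := by
  have hL : 0 < M + 2 * ε := by linarith [(norm_nonneg H).trans hM]
  have h1 := inner_p_le hH hM (hn.mono n.le_succ)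
  have h2 := hn.stepLength_mul n.lt_succ_self
  have h3 := hn.stepLength_pos n.lt_succ_self
  rw [quad_succ hH hn]
  have hr : 0 < ‖(state H g ε M n).r‖ ^ 2 := by
    have := norm_pos_iff.mpr (hn n n.lt_succ_self).1
    positivity
  have h4 : 1 ≤ stepLength H ε (state H g ε M n) * (M + 2 * ε) := by
    have := mul_le_mul_of_nonneg_left h1 h3.le
    rw [h2] at this
    by_contra hlt
    push Not at hlt
    nlinarith
  have h5 : ‖(state H g ε M n).r‖ ^ 2 / (2 * (M + 2 * ε)) ≤
      stepLength H ε (state H g ε M n) * ‖(state H g ε M n).r‖ ^ 2 / 2 := by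
    rw [div_le_iff₀ (by positivity)]
    nlinarith
  linarith

/-- The estimate sequence: as long as the curvature along `w - y_i` is at least `ε`, the quadratic
function at the CG iterates approaches its value at `w` at the accelerated rate. -/
theorem exists_estimate (hH : (H : Vec d →ₗ[ℝ] Vec d).IsSymmetric) (hM : ‖H‖ ≤ M)
    (hε : 0 < ε) {q : ℝ} (hq : 0 ≤ q) (hq1 : q ≤ 1) (hqκ : q ^ 2 * (M + 2 * ε) ≤ ε)
    {N : ℕ} (hN : Regular H g ε M N) (w : Vec d) (n : ℕ) (hn : n ≤ N)
    (hw : ∀ i < n, ε * ‖w - (state H g ε M i).y‖ ^ 2 ≤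
      inner ℝ (w - (state H g ε M i).y) (damped H ε (w - (state H g ε M i).y))) :
    ∃ (v : Vec d) (c : ℝ),
      (∀ m, n ≤ m → m ≤ N → inner ℝ (state H g ε M m).r v = 0) ∧
      quad H g ε (state H g ε M n).y ≤ c ∧
      c + ε / 2 * ‖w - v‖ ^ 2 ≤
        (1 - q) ^ n * (ε / 2 * ‖w‖ ^ 2) + (1 - (1 - q) ^ n) * quad H g ε w := by
  induction n with
  | zero => exact ⟨0, 0, by simp, by simp [state, init, quad], by simp⟩
  | succ n ih =>
    obtain ⟨v, c, hv, hc, hb⟩ := ih (by omega) (fun i hi => hw i (by omega))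
    have hL : 0 < M + 2 * ε := by linarith [(norm_nonneg H).trans hM]
    have hdec := quad_succ_le hH hM hε (hN.mono hn)
    have hexp := quad_expand (g := g) (ε := ε) (M := M) hH n w
    have hcur := hw n n.lt_succ_self
    have hrv := hv n le_rfl (by omega)
    have hry := inner_r_y hH (hN.mono (show n ≤ N by omega)) n le_rfl
    set y := (state H g ε M n).y with hy
    set r := (state H g ε M n).r with hr
    -- Minimizer and minimum of the next estimate function: (1-q) times the old one plus q times the
    -- model of curvature ε at y_n. The cross term q(1-q)⟨r, v-y⟩ vanishes by orthogonality, so CG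
    -- needs no extrapolation point.
    refine ⟨(1 - q) • v + q • y - (q / ε) • r,
      (1 - q) * c + q * quad H g ε y - q ^ 2 * ‖r‖ ^ 2 / (2 * ε) +
        ε / 2 * (q * (1 - q)) * ‖v - y‖ ^ 2, ?_, ?_, ?_⟩
    · intro m hm hmN
      rw [inner_sub_right, inner_add_right, real_inner_smul_right, real_inner_smul_right,
        real_inner_smul_right, hv m (by omega) hmN,
        inner_r_y hH (hN.mono hmN) n (by omega),
        (conjugacy hH m (hN.mono hmN)).r_r n (by omega)]
      ring
    · have h1 : q ^ 2 * ‖r‖ ^ 2 / (2 * ε) ≤ ‖r‖ ^ 2 / (2 * (M + 2 * ε)) := by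
        rw [div_le_div_iff₀ (by positivity) (by positivity)]
        nlinarith [mul_le_mul_of_nonneg_left hqκ (sq_nonneg ‖r‖)]
      have h2 : 0 ≤ ε / 2 * (q * (1 - q)) * ‖v - y‖ ^ 2 := by
        have : 0 ≤ 1 - q := by linarith
        positivity
      have h3 := mul_le_mul_of_nonneg_left hc (show 0 ≤ 1 - q by linarith)
      linarith
    · have hid : (1 - q) * c + q * quad H g ε y - q ^ 2 * ‖r‖ ^ 2 / (2 * ε) +
          ε / 2 * (q * (1 - q)) * ‖v - y‖ ^ 2 +
          ε / 2 * ‖w - ((1 - q) • v + q • y - (q / ε) • r)‖ ^ 2 =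
          (1 - q) * (c + ε / 2 * ‖w - v‖ ^ 2) +
          q * (quad H g ε y + inner ℝ r (w - y) + ε / 2 * ‖w - y‖ ^ 2) := by
        have e1 : w - ((1 - q) • v + q • y - (q / ε) • r) =
            (1 - q) • (w - v) + q • (w - y) + (q / ε) • r := by module
        have e2 : v - y = (w - y) - (w - v) := by abel
        have e3 : inner ℝ r (w - v) = inner ℝ r (w - y) := by
          rw [inner_sub_right, inner_sub_right, hrv, hry]
        rw [e1, e2]
        simp only [← real_inner_self_eq_norm_sq]
        generalize w - v = a at *
        generalize w - y = b at *
        simp only [inner_sub_left, inner_sub_right, inner_add_left, inner_add_right,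
          real_inner_smul_left, real_inner_smul_right, real_inner_comm r a, real_inner_comm r b,
          real_inner_comm b a, e3]
        field_simp
        ring
      rw [hid]
      have h1 := mul_le_mul_of_nonneg_left hb (show 0 ≤ 1 - q by linarith)
      have h2 : quad H g ε y + inner ℝ r (w - y) + ε / 2 * ‖w - y‖ ^ 2 ≤ quad H g ε w := by
        linarith
      have h3 := mul_le_mul_of_nonneg_left h2 hq
      have h4 : (1 - q) ^ (n + 1) = (1 - q) * (1 - q) ^ n := pow_succ' _ _
      rw [h4]
      linarith

/-! ### Constants of the residual test and slow decay -/

theorem two_le_kappa (hM : 0 ≤ M) (hε : 0 < ε) : 2 ≤ kappa M ε := by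
  rw [kappa, le_div_iff₀ hε]
  linarith

theorem tau_pos : 0 < tau M ε := by
  unfold tau
  positivity

theorem tau_lt_one (hM : 0 ≤ M) (hε : 0 < ε) : tau M ε < 1 := by
  have h : 0 < √(kappa M ε) := Real.sqrt_pos.mpr (by linarith [two_le_kappa hM hε])
  rw [tau, div_lt_one (by positivity)]
  linarith

/-- Makes q = τ admissible in `exists_estimate`. -/
theorem tau_sq_mul_le (hM : 0 ≤ M) (hε : 0 < ε) : tau M ε ^ 2 * (M + 2 * ε) ≤ ε := by
  have hκ := two_le_kappa hM hε
  have h1 : M + 2 * ε = kappa M ε * ε := by rw [kappa, div_mul_cancel₀ _ hε.ne']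
  have h2 : tau M ε ^ 2 * kappa M ε ≤ 1 := by
    rw [tau, div_pow, one_pow, one_div_mul_eq_div, div_le_one (by positivity)]
    nlinarith [Real.sq_sqrt (show 0 ≤ kappa M ε by linarith), Real.sqrt_nonneg (kappa M ε)]
  rw [h1, ← mul_assoc]
  exact mul_le_of_le_one_left hε.le h2

theorem two_mul_kappa_lt_capT (hM : 0 ≤ M) (hε : 0 < ε) : 2 * kappa M ε < capT M ε := by
  have hκ := two_le_kappa hM hε
  have hτ := tau_pos (M := M) (ε := ε)
  have hτ1 := tau_lt_one hM hε
  have h1 : √(1 - tau M ε) < 1 := by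
    rw [Real.sqrt_lt' one_pos]; linarith
  have h2 := Real.sqrt_nonneg (1 - tau M ε)
  have h3 : (1 - √(1 - tau M ε)) ^ 2 ≤ 1 := pow_le_one₀ (by linarith) (by linarith)
  have h4 : 0 < (1 - √(1 - tau M ε)) ^ 2 := pow_pos (by linarith) 2
  rw [capT, lt_div_iff₀ h4]
  have h5 : 2 * kappa M ε < 4 * kappa M ε ^ 4 := by
    have : 1 ≤ kappa M ε ^ 3 := one_le_pow₀ (by linarith)
    nlinarith
  nlinarith

theorem zetaHat_nonneg (hM : 0 ≤ M) (hε : 0 < ε) (hζ : 0 < ζ) : 0 ≤ zetaHat M ε ζ := by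
  have := two_le_kappa hM hε
  unfold zetaHat
  positivity

/-- If the curvature along `y_{j+1} - y_i` is at least `ε` for all `i < j`, then the residual
decays linearly. -/
theorem norm_r_sq_le (hH : (H : Vec d →ₗ[ℝ] Vec d).IsSymmetric) (hM : ‖H‖ ≤ M) (hε : 0 < ε)
    {j : ℕ} (hj : 1 ≤ j) (hR : Regular H g ε M (j + 1))
    (hw : ∀ i < j, ε * ‖(state H g ε M (j + 1)).y - (state H g ε M i).y‖ ^ 2 ≤
      inner ℝ ((state H g ε M (j + 1)).y - (state H g ε M i).y)
        (damped H ε ((state H g ε M (j + 1)).y - (state H g ε M i).y))) :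
    ‖(state H g ε M j).r‖ ^ 2 ≤ 2 * kappa M ε * ((1 - tau M ε) ^ j * ‖g‖ ^ 2) := by
  have hM0 : 0 ≤ M := (norm_nonneg H).trans hM
  have hτ1 := tau_lt_one hM0 hε
  obtain ⟨v, c, -, hc, hb⟩ := exists_estimate hH hM hε tau_pos.le hτ1.le
    (tau_sq_mul_le hM0 hε) hR _ j j.le_succ hw
  have hdec := quad_succ_le hH hM hε hR
  have hy := inner_damped_y hH hR
  -- Since y₀ = 0, the index i = 0 (available because j ≥ 1) gives curvature along y_{j+1} itself.
  have h0 := hw 0 hj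
  have hy0 : (state H g ε M 0).y = 0 := rfl
  rw [hy0, sub_zero] at h0
  have hq : quad H g ε (state H g ε M (j + 1)).y =
      inner ℝ (state H g ε M (j + 1)).y (damped H ε (state H g ε M (j + 1)).y) / 2 +
        inner ℝ g (state H g ε M (j + 1)).y := rfl
  set w := (state H g ε M (j + 1)).y
  have hgw : -inner ℝ g w ≤ ‖g‖ * ‖w‖ :=
    (neg_le_abs _).trans (abs_real_inner_le_norm g w)
  have hwn : ε * ‖w‖ ≤ ‖g‖ := by
    rcases eq_or_lt_of_le (norm_nonneg w) with h | h
    · rw [← h, mul_zero]; exact norm_nonneg g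
    · have : ε * ‖w‖ * ‖w‖ ≤ ‖g‖ * ‖w‖ := by nlinarith
      exact le_of_mul_le_mul_right this h
  -- As wᵀH̄w = -gᵀw, both terms on the left are at most -gᵀw/2, and ‖w‖ ≤ ‖g‖/ε.
  have hgap : ε / 2 * ‖w‖ ^ 2 - quad H g ε w ≤ ‖g‖ ^ 2 / ε := by
    rw [le_div_iff₀ hε]
    have h1 : ε / 2 * ‖w‖ ^ 2 - quad H g ε w ≤ ‖g‖ * ‖w‖ := by linarith
    nlinarith [norm_nonneg g, norm_nonneg w]
  have hp : 0 ≤ (1 - tau M ε) ^ j := pow_nonneg (by linarith) j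
  have h3 := mul_le_mul_of_nonneg_left hgap hp
  have h4 : 0 ≤ ε / 2 * ‖w - v‖ ^ 2 := by positivity
  -- The comparison point is w = y_{j+1}, so one further CG step bounds the residual by the gap
  -- between the values at y_j and w.
  have h5 : ‖(state H g ε M j).r‖ ^ 2 / (2 * (M + 2 * ε)) ≤
      (1 - tau M ε) ^ j * (‖g‖ ^ 2 / ε) := by linarith
  rw [div_le_iff₀ (by positivity)] at h5
  refine h5.trans (le_of_eq ?_)
  rw [kappa]
  field_simp

theorem sq_le_of_testSlow (hM : ‖H‖ ≤ M) (hε : 0 < ε) {j : ℕ}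
    (h : TestSlow g ε j (state H g ε M j)) :
    capT M ε * ((1 - tau M ε) ^ j * ‖g‖ ^ 2) ≤ ‖(state H g ε M j).r‖ ^ 2 := by
  have hM0 : 0 ≤ M := (norm_nonneg H).trans hM
  have hτ1 := tau_lt_one hM0 hε
  have hT : 0 ≤ capT M ε := by
    linarith [two_mul_kappa_lt_capT hM0 hε, two_le_kappa hM0 hε]
  rw [TestSlow, state_M hM, ge_iff_le] at h
  have h1 : 0 ≤ √(capT M ε) * (1 - tau M ε) ^ ((j : ℝ) / 2) * ‖g‖ := by
    have : 0 ≤ (1 - tau M ε) ^ ((j : ℝ) / 2) := Real.rpow_nonneg (by linarith) _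
    positivity
  refine le_trans (le_of_eq ?_) (pow_le_pow_left₀ h1 h 2)
  rw [mul_pow, mul_pow, Real.sq_sqrt hT, ← Real.rpow_natCast (_ ^ _) 2,
    ← Real.rpow_mul (by linarith)]
  norm_num
  ring

/-! ### Termination and output of capped CG -/

theorem Reaches.regular (hM : ‖H‖ ≤ M) (hε : 0 < ε) (hζ : 0 < ζ) (hg : g ≠ 0) {j : ℕ}
    (h : Reaches H g ε ζ M j) : Regular H g ε M j := by
  have hM0 : 0 ≤ M := (norm_nonneg H).trans hM
  intro i hi
  obtain ⟨-, h0, ht⟩ := h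
  rcases Nat.eq_zero_or_pos i with rfl | hi0
  · refine ⟨hg, lt_of_lt_of_le ?_ (not_lt.mp h0)⟩
    have := norm_pos_iff.mpr hg
    rw [norm_neg]
    positivity
  · obtain ⟨-, h2, h3, -⟩ := ht i hi0 hi
    constructor
    · intro hr
      apply h2
      rw [TestSol, state_M hM, hr, norm_zero]
      exact mul_nonneg (zetaHat_nonneg hM0 hε hζ) (norm_nonneg g)
    · exact lt_of_le_of_lt (by positivity) (not_le.mp h3)

theorem r_ne_zero_of_not_testSol (hM : ‖H‖ ≤ M) (hε : 0 < ε) (hζ : 0 < ζ) {j : ℕ}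
    (h : ¬ TestSol g ε ζ (state H g ε M j)) : (state H g ε M j).r ≠ 0 := by
  intro hr
  apply h
  rw [TestSol, state_M hM, hr, norm_zero]
  exact mul_nonneg (zetaHat_nonneg ((norm_nonneg H).trans hM) hε hζ) (norm_nonneg g)

theorem Reaches.succ {j : ℕ} (h : Reaches H g ε ζ M j)
    (hy : ¬ TestY H ε (state H g ε M j)) (hs : ¬ TestSol g ε ζ (state H g ε M j))
    (hp : ¬ TestP H ε (state H g ε M j)) (hl : ¬ TestSlow g ε j (state H g ε M j)) :
    Reaches H g ε ζ M (j + 1) := by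
  refine ⟨by omega, h.2.1, fun i hi1 hi => ?_⟩
  rcases Nat.lt_succ_iff_lt_or_eq.mp hi with hlt | rfl
  · exact h.2.2 i hi1 hlt
  · exact ⟨hy, hs, hp, hl⟩

/-- Slow decay of the residual reveals a direction of small curvature. -/
theorem exists_slow_direction (hH : (H : Vec d →ₗ[ℝ] Vec d).IsSymmetric) (hM : ‖H‖ ≤ M)
    (hε : 0 < ε) (hζ : 0 < ζ) (hg : g ≠ 0) {j : ℕ} (hj : Reaches H g ε ζ M j)
    (hy : ¬ TestY H ε (state H g ε M j)) (hs : ¬ TestSol g ε ζ (state H g ε M j))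
    (hp : ¬ TestP H ε (state H g ε M j)) (hl : TestSlow g ε j (state H g ε M j)) :
    ∃ t u, Returns H g ε ζ M t u := by
  have hM0 : 0 ≤ M := (norm_nonneg H).trans hM
  by_contra hno
  have hR : Regular H g ε M (j + 1) := by
    intro i hi
    rcases Nat.lt_succ_iff_lt_or_eq.mp hi with hlt | rfl
    · exact hj.regular hM hε hζ hg i hlt
    · exact ⟨r_ne_zero_of_not_testSol hM hε hζ hs,
        lt_of_le_of_lt (by positivity) (not_le.mp hp)⟩
  have hle := norm_r_sq_le hH hM hε hj.1 hR (fun i hi => by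
    by_contra hlt
    push Not at hlt
    have hw : (state H g ε M (j + 1)).y - (state H g ε M i).y ≠ 0 := by
      intro h0
      rw [h0] at hlt
      simp at hlt
    refine hno ⟨_, _, Returns.slow j i _ hj hy hs hp hl hi rfl hw ?_⟩
    have := norm_pos_iff.mpr hw
    rw [div_le_iff₀ (by positivity)]
    exact hlt.le)
  have hge := sq_le_of_testSlow hM hε hl
  have hpos : 0 < (1 - tau M ε) ^ j * ‖g‖ ^ 2 := by
    have h1 : 0 < 1 - tau M ε := by linarith [tau_lt_one hM0 hε]
    have h2 := norm_pos_iff.mpr hg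
    positivity
  have := mul_lt_mul_of_pos_right (two_mul_kappa_lt_capT hM0 hε) hpos
  linarith

/-- The capped CG procedure terminates. -/
theorem exists_returns (hH : (H : Vec d →ₗ[ℝ] Vec d).IsSymmetric) (hM : ‖H‖ ≤ M)
    (hε : 0 < ε) (hζ : 0 < ζ) (hg : g ≠ 0) : ∃ t u, Returns H g ε ζ M t u := by
  by_contra hno
  have h0 : ¬ InitialTest H g ε := fun h => hno ⟨_, _, Returns.initial h⟩
  have hreach : ∀ j, Reaches H g ε ζ M (j + 1) := by
    intro j
    induction j with
    | zero => exact ⟨le_rfl, h0, fun i h1 h2 => by omega⟩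
    | succ j ih =>
      have hy : ¬ TestY H ε (state H g ε M (j + 1)) :=
        fun h => hno ⟨_, _, Returns.curvY _ ih h⟩
      have hs : ¬ TestSol g ε ζ (state H g ε M (j + 1)) :=
        fun h => hno ⟨_, _, Returns.sol _ ih hy h⟩
      have hp : ¬ TestP H ε (state H g ε M (j + 1)) :=
        fun h => hno ⟨_, _, Returns.curvP _ ih hy hs h⟩
      exact ih.succ hy hs hp fun h => hno (exists_slow_direction hH hM hε hζ hg ih hy hs hp h)
  have hreg : ∀ n, Regular H g ε M (n + 1) := fun n => (hreach n).regular hM hε hζ hg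
  -- Without a return there would be infinitely many nonzero, pairwise orthogonal residuals in ℝ^d.
  have hli : LinearIndependent ℝ (fun n => (state H g ε M n).r) := by
    refine linearIndependent_of_ne_zero_of_inner_eq_zero
      (fun n => (hreg n n n.lt_succ_self).1) ?_
    intro m n hmn
    rcases lt_or_gt_of_ne hmn with h | h
    · change inner ℝ (state H g ε M m).r (state H g ε M n).r = 0
      rw [real_inner_comm]
      exact (conjugacy hH n ((hreg n).mono n.le_succ)).r_r m h
    · exact (conjugacy hH m ((hreg m).mono m.le_succ)).r_r n h
  exact not_finite_iff_infinite.mpr inferInstance hli.finite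

theorem Returns.negativeCurvature (hH : (H : Vec d →ₗ[ℝ] Vec d).IsSymmetric) (hM : ‖H‖ ≤ M)
    (hε : 0 < ε) (hζ : 0 < ζ) (hg : g ≠ 0) {u : Vec d}
    (h : Returns H g ε ζ M DirType.NC u) : u ≠ 0 ∧ inner ℝ u (H u) ≤ -ε * ‖u‖ ^ 2 := by
  have key : ∀ v : Vec d, inner ℝ v (damped H ε v) ≤ ε * ‖v‖ ^ 2 →
      inner ℝ v (H v) ≤ -ε * ‖v‖ ^ 2 := by
    intro v hv
    rw [inner_damped_self] at hv
    linarith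
  cases h with
  | initial h0 => exact ⟨neg_ne_zero.mpr hg, key _ h0.le⟩
  | curvY j hj hy => exact ⟨y_ne_zero hH hj.1 (hj.regular hM hε hζ hg), key _ hy⟩
  | curvP j hj _ hs hp =>
    exact ⟨p_ne_zero hH (hj.regular hM hε hζ hg) (r_ne_zero_of_not_testSol hM hε hζ hs), key _ hp⟩
  | slow j i w hj _ _ _ _ _ _ hw hc =>
    refine ⟨hw, key _ ?_⟩
    have := norm_pos_iff.mpr hw
    rwa [div_le_iff₀ (by positivity)] at hc

theorem Returns.solution (hH : (H : Vec d →ₗ[ℝ] Vec d).IsSymmetric) (hM : ‖H‖ ≤ M)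
    (hε : 0 < ε) (hζ : 0 < ζ) (hg : g ≠ 0) {u : Vec d}
    (h : Returns H g ε ζ M DirType.SOL u) :
    ε * ‖u‖ ^ 2 < inner ℝ u (damped H ε u) ∧ inner ℝ u (damped H ε u) = -inner ℝ g u ∧
      ‖g + damped H ε u‖ ≤ zetaHat M ε ζ * ‖g‖ := by
  cases h with
  | sol j hj hy hs =>
    refine ⟨not_le.mp hy, inner_damped_y hH (hj.regular hM hε hζ hg), ?_⟩
    rwa [TestSol, state_M hM, state_r] at hs

end CappedCG

variable {d : ℕ} {f : Vec d → ℝ}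

/-! ### Taylor bounds -/

theorem inner_gradient (f : Vec d → ℝ) (x v : Vec d) :
    inner ℝ (gradient f x) v = fderiv ℝ f x v := by
  rw [gradient, InnerProductSpace.toDual_symm_apply]

theorem differentiable_gradient (hf : ContDiff ℝ 2 f) : Differentiable ℝ (gradient f) := by
  have h1 : Differentiable ℝ (fderiv ℝ f) :=
    (hf.fderiv_right (m := 1) (by norm_num)).differentiable (by norm_num)
  exact (InnerProductSpace.toDual ℝ (Vec d)).symm.toContinuousLinearEquiv.differentiable.comp h1

theorem hasDerivAt_line (x u : Vec d) (t : ℝ) : HasDerivAt (fun s : ℝ => x + s • u) u t := by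
  simpa using ((hasDerivAt_id t).smul_const u).const_add x

theorem hasDerivAt_gradient_line (hf : ContDiff ℝ 2 f) (x u : Vec d) (t : ℝ) :
    HasDerivAt (fun s : ℝ => gradient f (x + s • u)) (hessian f (x + t • u) u) t :=
  HasFDerivAt.comp_hasDerivAt (l := gradient f) t
    (differentiable_gradient hf (x + t • u)).hasFDerivAt (hasDerivAt_line x u t)

theorem hasDerivAt_line_value (hf : ContDiff ℝ 2 f) (x u : Vec d) (t : ℝ) :
    HasDerivAt (fun s : ℝ => f (x + s • u)) (inner ℝ (gradient f (x + t • u)) u) t := by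
  rw [inner_gradient]
  exact ((hf.differentiable (by norm_num)) (x + t • u)).hasFDerivAt.comp_hasDerivAt t
    (hasDerivAt_line x u t)

theorem norm_hessian_line_le {x u : Vec d} {L : ℝ}
    (hL : ∀ y ∈ segment ℝ x (x + u), ‖hessian f y - hessian f x‖ ≤ L * ‖y - x‖)
    {t : ℝ} (h0 : 0 ≤ t) (h1 : t ≤ 1) :
    ‖hessian f (x + t • u) - hessian f x‖ ≤ L * (t * ‖u‖) := by
  have hmem : x + t • u ∈ segment ℝ x (x + u) := by
    rw [segment_eq_image']
    exact ⟨t, ⟨h0, h1⟩, by simp⟩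
  simpa [norm_smul, abs_of_nonneg h0] using hL _ hmem

/-- Second order Taylor bound for the gradient. -/
theorem norm_gradient_sub_le (hf : ContDiff ℝ 2 f) {x u : Vec d} {L : ℝ}
    (hL : ∀ y ∈ segment ℝ x (x + u), ‖hessian f y - hessian f x‖ ≤ L * ‖y - x‖)
    {t : ℝ} (ht : t ∈ Set.Icc (0 : ℝ) 1) :
    ‖gradient f (x + t • u) - gradient f x - t • hessian f x u‖ ≤ L / 2 * ‖u‖ ^ 2 * t ^ 2 := by
  have hder : ∀ s : ℝ, HasDerivAt
      (fun s : ℝ => gradient f (x + s • u) - gradient f x - s • hessian f x u)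
      (hessian f (x + s • u) u - hessian f x u) s := fun s =>
    (((hasDerivAt_gradient_line hf x u s).sub_const (gradient f x)).sub
      ((hasDerivAt_id s).smul_const (hessian f x u))).congr_deriv (by rw [one_smul])
  refine image_norm_le_of_norm_deriv_right_le_deriv_boundary
    (f' := fun s => hessian f (x + s • u) u - hessian f x u)
    (B := fun s => L / 2 * ‖u‖ ^ 2 * s ^ 2) (B' := fun s => L * s * ‖u‖ ^ 2)
    (fun s _ => (hder s).continuousAt.continuousWithinAt)
    (fun s _ => (hder s).hasDerivWithinAt) (by simp) (fun s => ?_) (fun s hs => ?_) ht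
  · have := (hasDerivAt_pow 2 s).const_mul (L / 2 * ‖u‖ ^ 2)
    refine this.congr_deriv ?_
    norm_num
    ring
  · have h1 := norm_hessian_line_le hL hs.1 hs.2.le
    rw [← _root_.sub_apply]
    refine (ContinuousLinearMap.le_of_opNorm_le _ h1 u).trans (le_of_eq ?_)
    ring

/-- Third order Taylor bound for the function. -/
theorem taylor_le (hf : ContDiff ℝ 2 f) {x u : Vec d} {L : ℝ}
    (hL : ∀ y ∈ segment ℝ x (x + u), ‖hessian f y - hessian f x‖ ≤ L * ‖y - x‖) :
    f (x + u) ≤ f x + inner ℝ (gradient f x) u + inner ℝ (hessian f x u) u / 2 +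
      L / 6 * ‖u‖ ^ 3 := by
  have hder : ∀ s : ℝ, HasDerivAt
      (fun s : ℝ => f (x + s • u) - f x - s * inner ℝ (gradient f x) u -
        s ^ 2 / 2 * inner ℝ (hessian f x u) u)
      (inner ℝ (gradient f (x + s • u) - gradient f x - s • hessian f x u) u) s := fun s => by
    have h1 := (((hasDerivAt_line_value hf x u s).sub_const (f x)).sub
      ((hasDerivAt_id s).mul_const (inner ℝ (gradient f x) u))).sub
      (((hasDerivAt_pow 2 s).div_const 2).mul_const (inner ℝ (hessian f x u) u))
    refine h1.congr_deriv ?_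
    rw [inner_sub_left, inner_sub_left, real_inner_smul_left]
    norm_num
  have := image_le_of_deriv_right_le_deriv_boundary
    (f' := fun s => inner ℝ (gradient f (x + s • u) - gradient f x - s • hessian f x u) u)
    (B := fun s => L / 6 * ‖u‖ ^ 3 * s ^ 3) (B' := fun s => L / 2 * ‖u‖ ^ 3 * s ^ 2)
    (a := 0) (b := 1)
    (fun s _ => (hder s).continuousAt.continuousWithinAt)
    (fun s _ => (hder s).hasDerivWithinAt) (by simp)
    (fun s _ => (((hasDerivAt_pow 3 s).const_mul
      (L / 6 * ‖u‖ ^ 3)).continuousAt.continuousWithinAt))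
    (fun s _ => (((hasDerivAt_pow 3 s).const_mul
      (L / 6 * ‖u‖ ^ 3)).congr_deriv (by norm_num; ring)).hasDerivWithinAt)
    (fun s hs => ?_) (Set.right_mem_Icc.mpr zero_le_one)
  · simp only [one_smul, one_mul, one_pow, mul_one] at this
    linarith
  · have h1 := norm_gradient_sub_le hf hL ⟨hs.1, hs.2.le⟩
    refine (real_inner_le_norm _ _).trans ?_
    refine (mul_le_mul_of_nonneg_right h1 (norm_nonneg u)).trans (le_of_eq ?_)
    ring

/-! ### The smallest eigenvalue -/

theorem le_lambdaMin {A : Mat d} {c : ℝ} (hc : c ≤ 0)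
    (h : ∀ v : Vec d, c * ‖v‖ ^ 2 ≤ inner ℝ v (A v)) : c ≤ lambdaMin A := by
  unfold lambdaMin
  rcases Set.eq_empty_or_nonempty
    {t : ℝ | Module.End.HasEigenvalue (A : Vec d →ₗ[ℝ] Vec d) t} with h0 | h0
  -- Without real eigenvalues, for instance when d = 0, `sInf ∅ = 0`; hence the assumption c ≤ 0.
  · rw [h0, Real.sInf_empty]; exact hc
  · refine le_csInf h0 fun t ht => ?_
    obtain ⟨v, hv⟩ := ht.exists_hasEigenvector
    have h1 := h v
    have h2 : A v = t • v := hv.apply_eq_smul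
    have h3 := norm_pos_iff.mpr hv.2
    rw [h2, real_inner_smul_right, real_inner_self_eq_norm_sq] at h1
    exact le_of_mul_le_mul_right h1 (by positivity)

/-- For a symmetric operator in finite dimension the infimum of the Rayleigh quotient is an
eigenvalue. The bound -‖A‖ makes both infima, over eigenvalues and over vectors, well behaved. -/
theorem lambdaMin_mul_le {A : Mat d} (hA : (A : Vec d →ₗ[ℝ] Vec d).IsSymmetric) (v : Vec d) :
    lambdaMin A * ‖v‖ ^ 2 ≤ inner ℝ v (A v) := by
  rcases eq_or_ne v 0 with rfl | hv
  · simp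
  have : Nontrivial (Vec d) := ⟨⟨v, 0, hv⟩⟩
  have hev := hA.hasEigenvalue_iInf_of_finiteDimensional
  have hbd : ∀ w : Vec d, -‖A‖ * ‖w‖ ^ 2 ≤ inner ℝ w (A w) := fun w => by
    have h1 := neg_abs_le (inner ℝ w (A w))
    have h2 := abs_real_inner_le_norm w (A w)
    have h3 := A.le_opNorm w
    nlinarith [norm_nonneg w]
  have h1 : lambdaMin A ≤ _ := csInf_le ⟨-‖A‖, fun t ht => by
    obtain ⟨w, hw⟩ := Module.End.HasEigenvalue.exists_hasEigenvector ht
    have h2 : A w = t • w := hw.apply_eq_smul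
    have h3 := norm_pos_iff.mpr hw.2
    have h4 := hbd w
    rw [h2, real_inner_smul_right, real_inner_self_eq_norm_sq] at h4
    exact le_of_mul_le_mul_right h4 (by positivity)⟩ hev
  have hn := norm_pos_iff.mpr hv
  rw [← le_div_iff₀ (by positivity)]
  refine h1.trans ?_
  have h5 := ciInf_le (f := fun x : { x : Vec d // x ≠ 0 } =>
    RCLike.re (inner ℝ ((A : Vec d →ₗ[ℝ] Vec d) x) (x : Vec d)) / ‖(x : Vec d)‖ ^ 2) ⟨-‖A‖, by
      rintro _ ⟨w, rfl⟩
      have := norm_pos_iff.mpr w.2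
      simp only
      rw [le_div_iff₀ (by positivity)]
      have h6 := hbd w
      rw [real_inner_comm] at h6
      exact h6⟩ ⟨v, hv⟩
  refine h5.trans (le_of_eq ?_)
  simp only
  rw [real_inner_comm]
  rfl

/-! ### Decrease of the objective function -/

/-- Quadratic model bound in terms of inexact derivatives. -/
theorem inexact_taylor_le (hf : ContDiff ℝ 2 f) {x u g : Vec d} {H : Mat d} {L a δg δH : ℝ}
    (ha : 0 ≤ a)
    (hL : ∀ y ∈ segment ℝ x (x + a • u), ‖hessian f y - hessian f x‖ ≤ L * ‖y - x‖)
    (hg : ‖g - gradient f x‖ ≤ δg) (hH : ‖H - hessian f x‖ ≤ δH) :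
    f (x + a • u) ≤ f x + a * (inner ℝ g u + δg * ‖u‖) +
      a ^ 2 / 2 * (inner ℝ u (H u) + δH * ‖u‖ ^ 2) + L / 6 * (a * ‖u‖) ^ 3 := by
  have h1 := taylor_le hf hL
  have h2 : inner ℝ (gradient f x) u ≤ inner ℝ g u + δg * ‖u‖ := by
    have := neg_le_of_abs_le (abs_real_inner_le_norm (g - gradient f x) u)
    rw [inner_sub_left] at this
    have := mul_le_mul_of_nonneg_right hg (norm_nonneg u)
    linarith
  have h3 : inner ℝ (hessian f x u) u ≤ inner ℝ u (H u) + δH * ‖u‖ ^ 2 := by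
    have e := neg_le_of_abs_le (abs_real_inner_le_norm ((H - hessian f x) u) u)
    have e2 := mul_le_mul_of_nonneg_right (ContinuousLinearMap.le_of_opNorm_le _ hH u)
      (norm_nonneg u)
    rw [_root_.sub_apply, inner_sub_left, real_inner_comm] at e
    rw [_root_.sub_apply] at e2
    nlinarith
  rw [map_smul, real_inner_smul_left, real_inner_smul_right, real_inner_smul_right, norm_smul,
    Real.norm_of_nonneg ha] at h1
  have h4 := mul_le_mul_of_nonneg_left h2 ha
  have h5 := mul_le_mul_of_nonneg_left h3 (show 0 ≤ a ^ 2 / 2 by positivity)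
  linarith

/-- Here G = gᵀu, Q = uᵀHu, n = ‖u‖. By the choice of a, the cubic term including η, the gradient
error and the Hessian error are each at most (1-ζ)/8 · a e n², while the exact model gains at least
a e n². -/
theorem sol_model_le {a n e ζ L η δg δH G Q : ℝ} (ha : 0 < a) (ha1 : a ≤ 1) (hn : 0 < n)
    (he : 0 < e) (hζ : 0 < ζ)
    (han : a ^ 2 * n * (4 * (L + η)) = 3 * (1 - ζ) * e)
    (hδg : δg ≤ (1 - ζ) / 8 * (e * n)) (hδH : δH ≤ (1 - ζ) / 4 * e)
    (hQ : e * n ^ 2 ≤ Q + 2 * e * n ^ 2) (hG : Q + 2 * e * n ^ 2 = -G) :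
    a * (G + δg * n) + a ^ 2 / 2 * (Q + δH * n ^ 2) + L / 6 * (a * n) ^ 3 ≤
      -(η / 6 * (a * n) ^ 3) := by
  have h1 : (L + η) / 6 * (a * n) ^ 3 = (1 - ζ) / 8 * (a * (e * n ^ 2)) := by
    linear_combination (a * n ^ 2 / 24) * han
  have h2 : a * (δg * n) ≤ (1 - ζ) / 8 * (a * (e * n ^ 2)) := by
    have := mul_le_mul_of_nonneg_left hδg (mul_pos ha hn).le
    linarith
  have h3 : a ^ 2 / 2 * (δH * n ^ 2) ≤ (1 - ζ) / 8 * (a ^ 2 * (e * n ^ 2)) := by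
    have := mul_le_mul_of_nonneg_left hδH (show 0 ≤ a ^ 2 / 2 * n ^ 2 by positivity)
    linarith
  have h4 : a * G + a ^ 2 / 2 * Q ≤ -(a * (e * n ^ 2)) - a ^ 2 / 2 * (e * n ^ 2) := by
    have hG' : G = -(Q + 2 * e * n ^ 2) := by linarith
    rw [hG']
    have : 0 ≤ a * (1 - a / 2) := mul_nonneg ha.le (by linarith)
    nlinarith [mul_nonneg this (sub_nonneg.mpr hQ)]
  have h5 : 0 < a * (e * n ^ 2) := by positivity
  have h6 : 0 < a ^ 2 * (e * n ^ 2) := by positivity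
  nlinarith [mul_pos hζ h5, mul_pos hζ h6]

theorem sol_decrease {P : Params} (hP : P.Valid) {ε : ℝ} (hε : 0 < ε) (hεg : P.εg = ε)
    (hεH : P.εH = √(P.LH * ε)) (hf : ContDiff ℝ 2 f) {x u g : Vec d} {H : Mat d} {δg : ℝ}
    (hL : ∀ y ∈ segment ℝ x (x + stepSize P δg ‖u‖ DirType.SOL • u),
      ‖hessian f y - hessian f x‖ ≤ P.LH * ‖y - x‖)
    (hg : ‖g - gradient f x‖ ≤ δg) (hH : ‖H - hessian f x‖ ≤ P.δH)
    (hδg : δg ≤ (1 - P.ζ) / 8 * (P.εH * ‖u‖)) (hδH : P.δH ≤ (1 - P.ζ) / 4 * P.εH)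
    (hu : P.εg / P.εH < ‖u‖)
    (hcurv : P.εH * ‖u‖ ^ 2 ≤ inner ℝ u (CappedCG.damped H P.εH u))
    (hres : inner ℝ u (CappedCG.damped H P.εH u) = -inner ℝ g u) :
    f (x + stepSize P δg ‖u‖ DirType.SOL • u) ≤
      f x - cSol P * P.LH ^ (3 / 2 : ℝ) * ε ^ (3 / 2 : ℝ) := by
  have he := hP.εH_pos
  have hLH := hP.LH_pos
  have hη := hP.η_pos
  have hζ := hP.ζ_pos
  have hζ1 : P.ζ < 1 := hP.ζ_lt.trans_le (min_le_left _ _)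
  have hn : 0 < ‖u‖ := lt_trans (div_pos hP.εg_pos he) hu
  have he2 : P.εH ^ 2 = P.LH * ε := by rw [hεH, Real.sq_sqrt (by positivity)]
  have hun : ε ≤ P.εH * ‖u‖ := by
    rw [hεg, div_lt_iff₀ he] at hu
    linarith
  set a := stepSize P δg ‖u‖ DirType.SOL with ha_def
  have ha_eq : a = √(3 * (1 - P.ζ) / (4 * (P.LH + P.η))) * (√P.εH / √‖u‖) := by
    simp only [ha_def, stepSize, Real.sqrt_eq_rpow]
  have h1ζ : 0 < 1 - P.ζ := by linarith
  have ha : 0 < a := by rw [ha_eq]; positivity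
  have hasq : a ^ 2 = 3 * (1 - P.ζ) / (4 * (P.LH + P.η)) * (P.εH / ‖u‖) := by
    rw [ha_eq, mul_pow, div_pow, Real.sq_sqrt (by positivity), Real.sq_sqrt he.le,
      Real.sq_sqrt hn.le]
  have han : a ^ 2 * ‖u‖ * (4 * (P.LH + P.η)) = 3 * (1 - P.ζ) * P.εH := by
    rw [hasq]; field_simp
  -- From ε_H‖u‖ ≥ ε and ε_H² = L_H ε: a² ≤ 3(1-ζ)L_H / (4(L_H+η)) < 1.
  have ha1 : a ≤ 1 := by
    by_contra hlt
    push Not at hlt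
    have h1 : 1 < a ^ 2 := one_lt_pow₀ hlt two_ne_zero
    have h2 : a ^ 2 * (4 * (P.LH + P.η)) * (P.εH * ‖u‖) = 3 * (1 - P.ζ) * (P.LH * ε) := by
      rw [← he2]
      linear_combination P.εH * han
    have h3 : 4 * (P.LH + P.η) * ε ≤ a ^ 2 * (4 * (P.LH + P.η)) * (P.εH * ‖u‖) := by
      apply mul_le_mul _ hun hε.le (by positivity)
      nlinarith
    nlinarith [mul_pos hLH hε, mul_pos hη hε, mul_pos hζ (mul_pos hLH hε)]
  have h1 := inexact_taylor_le (H := H) hf ha.le hL hg hH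
  rw [CappedCG.inner_damped_self] at hcurv hres
  have h2 := sol_model_le ha ha1 hn he hζ han hδg hδH hcurv hres
  have h3 : cSol P * P.LH ^ (3 / 2 : ℝ) * ε ^ (3 / 2 : ℝ) ≤ P.η / 6 * (a * ‖u‖) ^ 3 := by
    have e1 : cSol P * P.LH ^ (3 / 2 : ℝ) * ε ^ (3 / 2 : ℝ) =
        P.η / 6 * (3 * (1 - P.ζ) / (4 * (P.LH + P.η)) * ε) ^ (3 / 2 : ℝ) := by
      rw [cSol, mul_assoc, mul_assoc, ← Real.mul_rpow hLH.le hε.le,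
        ← Real.mul_rpow (by positivity) (by positivity)]
      congr 2
      field_simp
    have e2 : (a * ‖u‖) ^ 3 = ((a * ‖u‖) ^ 2) ^ (3 / 2 : ℝ) := by
      rw [← Real.rpow_natCast, ← Real.rpow_natCast, ← Real.rpow_mul (by positivity)]
      norm_num
    rw [e1, e2]
    refine mul_le_mul_of_nonneg_left (Real.rpow_le_rpow (by positivity) ?_ (by norm_num))
      (by positivity)
    have e3 : (a * ‖u‖) ^ 2 = 3 * (1 - P.ζ) / (4 * (P.LH + P.η)) * (P.εH * ‖u‖) := by
      rw [mul_pow, hasq]; field_simp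
    rw [e3]
    exact mul_le_mul_of_nonneg_left hun (by positivity)
  linarith

/-- The admissible range of step lengths along a direction of negative curvature. -/
theorem nc_step_bounds {b c K θ e δ : ℝ} (he : 0 < e) (hb : e / 8 ≤ b) (hK : 0 < K) (hδ : 0 ≤ δ)
    (hc : 4 * K * δ / 6 = c) (hcb : c ≤ b ^ 2 / 4) (hθ : (2 - √3) ^ 2 < θ) (hθ1 : θ < 1) :
    K / 6 * (θ * ((b + √(b ^ 2 - c)) / (K / 3))) ^ 2 -
        b * (θ * ((b + √(b ^ 2 - c)) / (K / 3))) + δ ≤ 0 := by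
  have hb0 : 0 < b := by linarith
  have h3 : √3 ^ 2 = 3 := Real.sq_sqrt (by norm_num)
  have h3' : 0 < √3 := by positivity
  have h32 : √3 < 2 := by nlinarith
  have hc0 : 0 ≤ c := by rw [← hc]; positivity
  have hθ0 : 0 < θ := lt_of_le_of_lt (sq_nonneg _) hθ
  set D := √(b ^ 2 - c) with hD
  have hD2 : D ^ 2 = b ^ 2 - c := Real.sq_sqrt (by nlinarith)
  have hD0 : 0 ≤ D := Real.sqrt_nonneg _
  have hDb : D ≤ b := by
    by_contra h
    push Not at h
    nlinarith
  have hDl : √3 / 2 * b ≤ D := by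
    by_contra h
    push Not at h
    have : D ^ 2 < (√3 / 2 * b) ^ 2 := pow_lt_pow_left₀ h hD0 two_ne_zero
    nlinarith
  -- D ≥ (√3/2)b bounds the ratio of the roots: (b-D)/(b+D) ≤ (2-√3)/(2+√3) = (2-√3)². This is the
  -- origin of the lower limit on θ.
  have hkey : b - D ≤ θ * (b + D) := by
    have h1 : (2 - √3) ^ 2 * (b + D) ≤ θ * (b + D) :=
      mul_le_mul_of_nonneg_right hθ.le (by linarith)
    have h2 : (2 - √3) ^ 2 = 7 - 4 * √3 := by nlinarith
    rw [h2] at h1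
    have h4 : 0 ≤ (8 - 4 * √3) * (D - √3 / 2 * b) :=
      mul_nonneg (by linarith) (by linarith)
    nlinarith
  -- The roots are (b ± D)/(K/3), and the argument is θ times the larger one.
  have hfac : K / 6 * (θ * ((b + D) / (K / 3))) ^ 2 - b * (θ * ((b + D) / (K / 3))) + δ =
      (3 / (2 * K)) * ((θ * (b + D) - (b - D)) * (θ * (b + D) - (b + D))) := by
    have hδ' : δ = 3 * (b ^ 2 - D ^ 2) / (2 * K) := by
      rw [hD2, ← hc]; field_simp; ring
    rw [hδ']
    field_simp
    ring
  rw [hfac]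
  refine mul_nonpos_of_nonneg_of_nonpos (by positivity) ?_
  refine mul_nonpos_of_nonneg_of_nonpos (by linarith) ?_
  nlinarith

theorem nc_decrease {P : Params} (hP : P.Valid) {ε : ℝ} (hε : 0 < ε)
    (hεH : P.εH = √(P.LH * ε)) (hf : ContDiff ℝ 2 f) {x u g : Vec d} {H : Mat d} {δg : ℝ}
    (hL : ∀ y ∈ segment ℝ x (x + stepSize P δg ‖u‖ DirType.NC • u),
      ‖hessian f y - hessian f x‖ ≤ P.LH * ‖y - x‖)
    (hg : ‖g - gradient f x‖ ≤ δg) (hH : ‖H - hessian f x‖ ≤ P.δH)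
    (hδg : δg ≤ (1 - P.ζ) / 8 * (3 * P.εH ^ 2 / (65 * (P.LH + P.η))))
    (hδH : P.δH ≤ (1 - P.ζ) / 4 * P.εH)
    (hu : P.εH / 2 ≤ ‖u‖) (hcurv : inner ℝ u (H u) = -‖u‖ ^ 3) (hdesc : inner ℝ g u ≤ 0) :
    f (x + stepSize P δg ‖u‖ DirType.NC • u) ≤
      f x - cNC P / 8 * P.LH ^ (3 / 2 : ℝ) * ε ^ (3 / 2 : ℝ) := by
  have he := hP.εH_pos
  have hLH := hP.LH_pos
  have hη := hP.η_pos
  have hζ := hP.ζ_pos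
  have hζ1 : P.ζ < 1 := hP.ζ_lt.trans_le (min_le_left _ _)
  have hθ0 : 0 < P.θt := lt_of_le_of_lt (sq_nonneg _) hP.θt_gt
  have hn : 0 < ‖u‖ := by linarith
  have hδ0 : 0 ≤ δg := (norm_nonneg _).trans hg
  set b := (‖u‖ - P.δH) / 2 with hb_def
  have hb : P.εH * (1 + P.ζ) / 8 ≤ b := by rw [hb_def]; linarith
  have hb8 : P.εH / 8 ≤ b := by nlinarith
  have hK : 0 < P.LH + P.η := by linarith
  -- The constant 65 in the gradient accuracy gives at most ε_H²/260 on the left, and b ≥ ε_H/8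
  -- gives at least ε_H²/256 on the right.
  have hcb : 4 * (P.LH + P.η) * δg / 6 ≤ b ^ 2 / 4 := by
    have h1 : 4 * (P.LH + P.η) * δg / 6 ≤ (1 - P.ζ) * P.εH ^ 2 / 260 := by
      have := mul_le_mul_of_nonneg_left hδg (show 0 ≤ 4 * (P.LH + P.η) / 6 by positivity)
      have e : 4 * (P.LH + P.η) / 6 * ((1 - P.ζ) / 8 * (3 * P.εH ^ 2 / (65 * (P.LH + P.η)))) =
          (1 - P.ζ) * P.εH ^ 2 / 260 := by
        field_simp; ring
      linarith
    have h2 : (P.εH / 8) ^ 2 ≤ b ^ 2 := pow_le_pow_left₀ (by positivity) hb8 2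
    nlinarith [mul_pos hζ (pow_pos he 2), pow_pos he 2]
  have hq := nc_step_bounds he hb8 hK hδ0 rfl hcb hP.θt_gt hP.θt_lt
  set s := P.θt * ((b + √(b ^ 2 - 4 * (P.LH + P.η) * δg / 6)) / ((P.LH + P.η) / 3)) with hs
  set a := stepSize P δg ‖u‖ DirType.NC with ha_def
  have has : a * ‖u‖ = s := by
    simp only [ha_def, stepSize, hs]
    rw [← hb_def]
    field_simp
  have hb0 : 0 < b := by linarith
  have hs_pos : 0 < s := by
    have := Real.sqrt_nonneg (b ^ 2 - 4 * (P.LH + P.η) * δg / 6)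
    positivity
  have ha : 0 < a := by
    by_contra h
    push Not at h
    nlinarith
  have h1 := inexact_taylor_le (H := H) hf ha.le hL hg hH
  rw [hcurv, has] at h1
  have h2 : a * (inner ℝ g u + δg * ‖u‖) + a ^ 2 / 2 * (-‖u‖ ^ 3 + P.δH * ‖u‖ ^ 2) +
      P.LH / 6 * s ^ 3 ≤ -(P.η / 6 * s ^ 3) := by
    have e1 : a * (inner ℝ g u + δg * ‖u‖) ≤ δg * s := by
      have := mul_nonpos_of_nonneg_of_nonpos ha.le hdesc
      rw [← has]; linarith
    have e2 : a ^ 2 / 2 * (-‖u‖ ^ 3 + P.δH * ‖u‖ ^ 2) = -(b * s ^ 2) := by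
      rw [← has, hb_def]; ring
    have e3 := mul_nonpos_of_nonneg_of_nonpos hs_pos.le hq
    rw [e2]
    linarith
  have h3 : cNC P / 8 * P.LH ^ (3 / 2 : ℝ) * ε ^ (3 / 2 : ℝ) ≤ P.η / 6 * s ^ 3 := by
    have e1 : P.LH ^ (3 / 2 : ℝ) * ε ^ (3 / 2 : ℝ) = P.εH ^ 3 := by
      rw [← Real.mul_rpow hLH.le hε.le, hεH, Real.sqrt_eq_rpow, ← Real.rpow_natCast,
        ← Real.rpow_mul (by positivity)]
      norm_num
    have e2 : cNC P / 8 * P.εH ^ 3 =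
        P.η / 6 * (3 * P.θt / (4 * (P.LH + P.η)) * (P.εH / 2)) ^ 3 := by
      rw [cNC]; ring
    rw [mul_assoc, e1, e2]
    refine mul_le_mul_of_nonneg_left (pow_le_pow_left₀ (by positivity) ?_ 3) (by positivity)
    have e3 : b ≤ b + √(b ^ 2 - 4 * (P.LH + P.η) * δg / 6) :=
      le_add_of_nonneg_right (Real.sqrt_nonneg _)
    -- Dropping the square root and using b ≥ ε_H/8 gives s ≥ 3θ/(4(L_H+η)) · ε_H/2; cubing the last
    -- half produces the 8 in c_nc/8.
    have e4 : P.θt * (P.εH / 8 / ((P.LH + P.η) / 3)) ≤ s := by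
      rw [hs]
      gcongr
      linarith
    refine le_trans (le_of_eq ?_) e4
    field_simp
    norm_num
  linarith

/-- Scaling by the curvature makes the quadratic term a pure cubic in the length, as `nc_decrease`
requires; the sign excludes ascent. -/
theorem negativeCurvature_direction {w g : Vec d} {H : Mat d} {s : ℝ} (hw : ‖w‖ = 1)
    (hs : s = 1 ∨ s = -1) (hsg : 0 ≤ s * inner ℝ w g) (hneg : inner ℝ w (H w) ≤ 0) :
    ‖-((s * |inner ℝ w (H w)|) • w)‖ = |inner ℝ w (H w)| ∧
      inner ℝ (-((s * |inner ℝ w (H w)|) • w)) (H (-((s * |inner ℝ w (H w)|) • w))) =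
        -‖-((s * |inner ℝ w (H w)|) • w)‖ ^ 3 ∧
      inner ℝ g (-((s * |inner ℝ w (H w)|) • w)) ≤ 0 := by
  have hs2 : s * s = 1 := by rcases hs with rfl | rfl <;> norm_num
  have hs1 : |s| = 1 := by rcases hs with rfl | rfl <;> norm_num
  have hnorm : ‖-((s * |inner ℝ w (H w)|) • w)‖ = |inner ℝ w (H w)| := by
    rw [norm_neg, norm_smul, hw, mul_one, Real.norm_eq_abs, abs_mul, hs1, one_mul, abs_abs]
  refine ⟨hnorm, ?_, ?_⟩
  · rw [hnorm, map_neg, map_smul, inner_neg_neg, real_inner_smul_left, real_inner_smul_right,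
      abs_of_nonpos hneg]
    linear_combination (inner ℝ w (H w)) ^ 3 * hs2
  · rw [inner_neg_right, real_inner_smul_right, real_inner_comm w g]
    have := mul_nonneg hsg (abs_nonneg (inner ℝ w (H w)))
    linarith

variable {x₀ : Vec d} {flow Lg ε : ℝ} {P : Params}
  {Ω : Type*} {R : Trace Ω d}

/-! ### Runs of the method -/

/-- The guaranteed decrease of the objective function in an iteration that takes a step. -/
def decrease (P : Params) (ε : ℝ) : ℝ :=
  min (cSol P) (cNC P / 8) * P.LH ^ (3 / 2 : ℝ) * ε ^ (3 / 2 : ℝ)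

theorem decrease_pos (hP : P.Valid) (hε : 0 < ε) : 0 < decrease P ε := by
  have hLH := hP.LH_pos
  have hη := hP.η_pos
  have hζ1 : 0 < 1 - P.ζ := by linarith [hP.ζ_lt.trans_le (min_le_left 1 P.UH)]
  have hθ0 : 0 < P.θt := lt_of_le_of_lt (sq_nonneg _) hP.θt_gt
  have h1 : 0 < cSol P := by unfold cSol; positivity
  have h2 : 0 < cNC P := by unfold cNC; positivity
  have h3 : 0 < min (cSol P) (cNC P / 8) := lt_min h1 (by positivity)
  unfold decrease
  positivity

theorem decrease_le_sol (hP : P.Valid) (hε : 0 < ε) :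
    decrease P ε ≤ cSol P * P.LH ^ (3 / 2 : ℝ) * ε ^ (3 / 2 : ℝ) := by
  have hLH := hP.LH_pos
  unfold decrease
  gcongr
  exact min_le_left _ _

theorem decrease_le_nc (hP : P.Valid) (hε : 0 < ε) :
    decrease P ε ≤ cNC P / 8 * P.LH ^ (3 / 2 : ℝ) * ε ^ (3 / 2 : ℝ) := by
  have hLH := hP.LH_pos
  unfold decrease
  gcongr
  exact min_le_right _ _

/-- The count gives n ≤ ⌈Δ/decrease⌉; the factor 2 and the summand 3 leave slack. -/
theorem le_iterationBound (hP : P.Valid) (hε : 0 < ε) {Δ : ℝ} {n : ℕ}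
    (h : n * decrease P ε ≤ Δ) : n < iterationBound P Δ ε := by
  have hd := decrease_pos hP hε
  have e : Δ / (min (cSol P) (cNC P / 8) * P.LH ^ (3 / 2 : ℝ)) * ε ^ (-(3 / 2) : ℝ) =
      Δ / decrease P ε := by
    rw [Real.rpow_neg hε.le, decrease, ← div_eq_mul_inv, div_div]
  have h1 : (n : ℝ) ≤ Δ / decrease P ε := by rwa [le_div_iff₀ hd]
  have h2 : n ≤ ⌈Δ / decrease P ε⌉₊ := by exact_mod_cast h1.trans (Nat.le_ceil _)
  rw [iterationBound, e]
  omega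

theorem SmoothnessAssumption.hessian_dir (hS : SmoothnessAssumption f x₀ flow Lg P.LH R)
    {k : ℕ} {ω : Ω} (hk : ¬ R.stopped k ω) :
    ∀ y ∈ segment ℝ (R.x k ω) (R.x k ω + R.dir k ω),
      ‖hessian f y - hessian f (R.x k ω)‖ ≤ P.LH * ‖y - R.x k ω‖ := by
  obtain ⟨B, -, hB, -, hH⟩ := hS.lipschitz
  exact fun y hy => hH y ((hB k ω hk).1 hy) _ ((hB k ω hk).1 (left_mem_segment ℝ _ _))

theorem SmoothnessAssumption.hessian_step (hS : SmoothnessAssumption f x₀ flow Lg P.LH R)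
    {k : ℕ} {ω : Ω} (hk : ¬ R.stopped k ω) :
    ∀ y ∈ segment ℝ (R.x k ω) (R.x (k + 1) ω),
      ‖hessian f y - hessian f (R.x k ω)‖ ≤ P.LH * ‖y - R.x k ω‖ := by
  obtain ⟨B, -, hB, -, hH⟩ := hS.lipschitz
  exact fun y hy => hH y ((hB k ω hk).2 hy) _ ((hB k ω hk).2 (left_mem_segment ℝ _ _))

/-- The first entry of the outer minimum suffices, so the values of d_k and g_{k+1} at a halt play
no role. -/
theorem InexactnessCondition.δg_le_eps (hP : P.Valid) (hε : 0 < ε)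
    (hεH : P.εH = √(P.LH * ε)) (hI : InexactnessCondition P f R) {k : ℕ} {ω : Ω}
    (hk : ¬ R.stopped k ω) : R.δg k ω ≤ ε / 8 := by
  have hLH := hP.LH_pos
  have hη := hP.η_pos
  have hζ := hP.ζ_pos
  have hζ1 : P.ζ < 1 := hP.ζ_lt.trans_le (min_le_left _ _)
  have he2 : P.εH ^ 2 = P.LH * ε := by rw [hεH, Real.sq_sqrt (by positivity)]
  have h1 : 3 * P.εH ^ 2 / (65 * (P.LH + P.η)) ≤ ε := by
    rw [div_le_iff₀ (by positivity), he2]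
    nlinarith [mul_pos hLH hε, mul_pos hη hε]
  have h2 := (hI.δg_le k ω hk).trans
    (mul_le_mul_of_nonneg_left ((min_le_left _ _).trans h1) (by linarith))
  nlinarith

/-- The oracle is called in iteration `k` with a matrix that has an eigenvalue below `-ε_H`. -/
def criticalCall (P : Params) (R : Trace Ω d) (k : ℕ) : Set Ω :=
  {ω | ¬ R.stopped k ω ∧ CallsOracle P (R.g k ω) (R.cgType k ω) (R.cgDir k ω) ∧
    lambdaMin (R.H k ω) < -P.εH}

/-- No wrong certificate has been issued in the iterations before `n`. -/
def reliable (P : Params) (R : Trace Ω d) (n : ℕ) : Set Ω :=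
  {ω | ∀ k < n, ω ∉ criticalCall P R k ∩ {ω | R.oracle k ω = none}}

theorem reliable_succ (P : Params) (R : Trace Ω d) (n : ℕ) :
    reliable P R (n + 1) = reliable P R n \
      (reliable P R n ∩ criticalCall P R n ∩ {ω | R.oracle n ω = none}) := by
  ext ω
  simp only [reliable, Set.mem_ofPred_eq, Set.mem_sdiff, Set.mem_inter_iff, Nat.forall_lt_succ_right]
  tauto

/-- Decrease along a direction that is built from a unit vector of negative curvature. -/
theorem unit_direction_decrease (hP : P.Valid) (hε : 0 < ε) (hεH : P.εH = √(P.LH * ε))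
    (hS : SmoothnessAssumption f x₀ flow Lg P.LH R) (hI : InexactnessCondition P f R)
    {k : ℕ} {ω : Ω} (hk : ¬ R.stopped k ω) {w : Vec d} {s : ℝ} (hw : ‖w‖ = 1)
    (hs : s = 1 ∨ s = -1) (hsg : 0 ≤ s * inner ℝ w (R.g k ω))
    (hneg : inner ℝ w (R.H k ω w) ≤ -P.εH / 2)
    (hx : R.x (k + 1) ω = R.x k ω + stepSize P (R.δg k ω)
      ‖-((s * |inner ℝ w (R.H k ω w)|) • w)‖ DirType.NC •
        -((s * |inner ℝ w (R.H k ω w)|) • w)) :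
    f (R.x (k + 1) ω) ≤ f (R.x k ω) - decrease P ε := by
  have he := hP.εH_pos
  have hζ1 : P.ζ < 1 := hP.ζ_lt.trans_le (min_le_left _ _)
  have hL := hS.hessian_step hk
  obtain ⟨h1, h2, h3⟩ := negativeCurvature_direction (H := R.H k ω) hw hs hsg (by linarith)
  have hδ : R.δg k ω ≤ (1 - P.ζ) / 8 * (3 * P.εH ^ 2 / (65 * (P.LH + P.η))) :=
    (hI.δg_le k ω hk).trans (mul_le_mul_of_nonneg_left (min_le_left _ _) (by linarith))
  have hnorm : P.εH / 2 ≤ ‖-((s * |inner ℝ w (R.H k ω w)|) • w)‖ := by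
    rw [h1, abs_of_nonpos (by linarith)]
    linarith
  rw [hx] at hL ⊢
  refine (nc_decrease hP hε hεH hS.contDiff hL (hI.gradient_accuracy k ω hk)
    (hI.hessian_accuracy k ω hk) hδ hI.δH_le hnorm h2 h3).trans ?_
  linarith [decrease_le_nc hP hε]

variable [mΩ : MeasurableSpace Ω] {μ : Measure Ω} {ℱ : Filtration ℕ mΩ}

theorem IsRun.exists_returns (hP : P.Valid) (hR : IsRun P x₀ μ ℱ R) {k : ℕ} {ω : Ω}
    (hk : ¬ R.stopped k ω) (hg : P.εg ≤ ‖R.g k ω‖) :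
    ∃ t u, CappedCG.Returns (R.H k ω) (R.g k ω) P.εH P.ζ P.UH t u :=
  CappedCG.exists_returns (hR.hessians k ω hk).1 (hR.hessians k ω hk).2 hP.εH_pos hP.ζ_pos
    (norm_pos_iff.mp (hP.εg_pos.trans_le hg))

theorem IsRun.negativeCurvature (hP : P.Valid) (hR : IsRun P x₀ μ ℱ R) {k : ℕ} {ω : Ω}
    (hk : ¬ R.stopped k ω) (hg : P.εg ≤ ‖R.g k ω‖) (ht : R.cgType k ω = DirType.NC) :
    R.cgDir k ω ≠ 0 ∧ inner ℝ (R.cgDir k ω) (R.H k ω (R.cgDir k ω)) ≤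
      -P.εH * ‖R.cgDir k ω‖ ^ 2 := by
  have h := hR.cg_call k ω hk hg (hR.exists_returns hP hk hg)
  rw [ht] at h
  exact h.negativeCurvature (hR.hessians k ω hk).1 (hR.hessians k ω hk).2 hP.εH_pos hP.ζ_pos
    (norm_pos_iff.mp (hP.εg_pos.trans_le hg))

theorem IsRun.solution (hP : P.Valid) (hR : IsRun P x₀ μ ℱ R) {k : ℕ} {ω : Ω}
    (hk : ¬ R.stopped k ω) (hg : P.εg ≤ ‖R.g k ω‖) (ht : R.cgType k ω = DirType.SOL) :
    P.εH * ‖R.cgDir k ω‖ ^ 2 <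
        inner ℝ (R.cgDir k ω) (CappedCG.damped (R.H k ω) P.εH (R.cgDir k ω)) ∧
      inner ℝ (R.cgDir k ω) (CappedCG.damped (R.H k ω) P.εH (R.cgDir k ω)) =
        -inner ℝ (R.g k ω) (R.cgDir k ω) ∧
      ‖R.g k ω + CappedCG.damped (R.H k ω) P.εH (R.cgDir k ω)‖ ≤
        CappedCG.zetaHat P.UH P.εH P.ζ * ‖R.g k ω‖ := by
  have h := hR.cg_call k ω hk hg (hR.exists_returns hP hk hg)
  rw [ht] at h
  exact h.solution (hR.hessians k ω hk).1 (hR.hessians k ω hk).2 hP.εH_pos hP.ζ_pos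
    (norm_pos_iff.mp (hP.εg_pos.trans_le hg))

theorem objective_decrease (hP : P.Valid) (hε : 0 < ε) (hεg : P.εg = ε)
    (hεH : P.εH = √(P.LH * ε)) (hR : IsRun P x₀ μ ℱ R)
    (hS : SmoothnessAssumption f x₀ flow Lg P.LH R) (hI : InexactnessCondition P f R)
    {k : ℕ} {ω : Ω} (hk : ¬ R.stopped k ω) (hk1 : ¬ R.stopped (k + 1) ω) :
    f (R.x (k + 1) ω) ≤ f (R.x k ω) - decrease P ε := by
  have he := hP.εH_pos
  have hζ1 : P.ζ < 1 := hP.ζ_lt.trans_le (min_le_left _ _)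
  obtain ⟨o, hit, ho⟩ := hR.iteration k ω hk
  cases hit with
  | cgNC s hg ht hs =>
    obtain ⟨-, -, hx⟩ := ho
    obtain ⟨hu0, hu⟩ := hR.negativeCurvature hP hk hg ht
    set u := R.cgDir k ω
    have hn : 0 < ‖u‖ := norm_pos_iff.mpr hu0
    have hq : inner ℝ (‖u‖⁻¹ • u) (R.H k ω (‖u‖⁻¹ • u)) = inner ℝ u (R.H k ω u) / ‖u‖ ^ 2 := by
      rw [map_smul, real_inner_smul_left, real_inner_smul_right]
      field_simp
    -- In terms of w = u/‖u‖ the CG direction takes the same form as an oracle direction.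
    have ha : |inner ℝ u (R.H k ω u)| / ‖u‖ ^ 2 =
        |inner ℝ (‖u‖⁻¹ • u) (R.H k ω (‖u‖⁻¹ • u))| := by
      rw [hq, abs_div, abs_of_pos (show 0 < ‖u‖ ^ 2 by positivity)]
    rw [ha] at hx
    refine unit_direction_decrease hP hε hεH hS hI hk (w := ‖u‖⁻¹ • u) ?_ hs.1 ?_ ?_ hx
    · rw [norm_smul, norm_inv, norm_norm, inv_mul_cancel₀ hn.ne']
    · rw [real_inner_smul_left, mul_left_comm, hs.2]
      positivity
    · rw [hq, div_le_iff₀ (by positivity)]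
      nlinarith [mul_pos he (pow_pos hn 2)]
  | cgSol hg ht hu =>
    obtain ⟨hd, -, hx⟩ := ho
    obtain ⟨h1, h2, -⟩ := hR.solution hP hk hg ht
    have hL := hS.hessian_step hk
    have hδ := hI.δg_le k ω hk
    rw [hd] at hδ
    have hδ' : R.δg k ω ≤ (1 - P.ζ) / 8 * (P.εH * ‖R.cgDir k ω‖) := by
      refine hδ.trans (mul_le_mul_of_nonneg_left ((min_le_right _ _).trans ?_) (by linarith))
      -- A long SOL direction has ε_g < ε_H‖d_k‖, so the inner maximum is at most ε_H‖d_k‖.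
      refine max_le ?_ (min_le_left _ _)
      rw [div_lt_iff₀ he] at hu
      linarith
    rw [hx] at hL ⊢
    refine (sol_decrease hP hε hεg hεH hS.contDiff hL (hI.gradient_accuracy k ω hk)
      (hI.hessian_accuracy k ω hk) hδ' hI.δH_le hu h1.le h2).trans ?_
    linarith [decrease_le_sol hP hε]
  | smallSolStop => exact absurd ho.2.1 hk1
  | smallSolNC v s hg ht hu ha hs =>
    obtain ⟨hv, hvH⟩ := hR.oracle_direction k ω hk (Or.inr ⟨hg, ht, hu⟩) v ha
    exact unit_direction_decrease hP hε hεH hS hI hk hv hs.1 (hs.2 ▸ abs_nonneg _) hvH ho.2.2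
  | smallGradStop => exact absurd ho.2.1 hk1
  | smallGradNC v s hg ha hs =>
    obtain ⟨hv, hvH⟩ := hR.oracle_direction k ω hk (Or.inl hg) v ha
    exact unit_direction_decrease hP hε hεH hS hI hk hv hs.1 (hs.2 ▸ abs_nonneg _) hvH ho.2.2

theorem IsRun.not_stopped_of_succ (hR : IsRun P x₀ μ ℱ R) {k : ℕ} {ω : Ω}
    (h : ¬ R.stopped (k + 1) ω) : ¬ R.stopped k ω := fun hk => h (hR.after k ω hk).1

theorem objective_le (hP : P.Valid) (hε : 0 < ε) (hεg : P.εg = ε)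
    (hεH : P.εH = √(P.LH * ε)) (hR : IsRun P x₀ μ ℱ R)
    (hS : SmoothnessAssumption f x₀ flow Lg P.LH R) (hI : InexactnessCondition P f R)
    (n : ℕ) (ω : Ω) (hn : ¬ R.stopped n ω) :
    f (R.x n ω) ≤ f x₀ - n * decrease P ε := by
  induction n with
  | zero => simp [(hR.start ω).2]
  | succ n ih =>
    have h0 := hR.not_stopped_of_succ hn
    have h1 := objective_decrease hP hε hεg hεH hR hS hI h0 hn
    have h2 := ih h0
    push_cast
    linarith

theorem stopped_iterationBound (hP : P.Valid) (hε : 0 < ε) (hεg : P.εg = ε)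
    (hεH : P.εH = √(P.LH * ε)) (hR : IsRun P x₀ μ ℱ R)
    (hS : SmoothnessAssumption f x₀ flow Lg P.LH R) (hI : InexactnessCondition P f R)
    (ω : Ω) : R.stopped (iterationBound P (f x₀ - flow) ε) ω := by
  by_contra hn
  have h1 := objective_le hP hε hεg hεH hR hS hI _ ω hn
  have h2 := hS.bounded_below (R.x (iterationBound P (f x₀ - flow) ε) ω)
  exact lt_irrefl _ (le_iterationBound hP hε
    (show (iterationBound P (f x₀ - flow) ε : ℕ) * decrease P ε ≤ f x₀ - flow by linarith))

/-! ### The returned point -/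

theorem IsRun.exists_halting (hR : IsRun P x₀ μ ℱ R) {n : ℕ} {ω : Ω} (hn : R.stopped n ω) :
    ∃ k < n, ¬ R.stopped k ω ∧ R.stopped (k + 1) ω ∧ R.x n ω = R.x (k + 1) ω := by
  induction n with
  | zero => exact absurd hn (hR.start ω).1
  | succ n ih =>
    by_cases h : R.stopped n ω
    · obtain ⟨k, hkn, hk, hk1, hx⟩ := ih h
      exact ⟨k, by omega, hk, hk1, by rw [(hR.after n ω h).2, hx]⟩
    · exact ⟨n, n.lt_succ_self, h, hn, rfl⟩

/-- The situation when the method terminates. -/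
theorem IsRun.halting (hP : P.Valid) (hR : IsRun P x₀ μ ℱ R) {k : ℕ} {ω : Ω}
    (hk : ¬ R.stopped k ω) (hk1 : R.stopped (k + 1) ω) :
    R.oracle k ω = none ∧ CallsOracle P (R.g k ω) (R.cgType k ω) (R.cgDir k ω) ∧
      R.x (k + 1) ω = R.x k ω + R.dir k ω ∧ ‖R.dir k ω‖ ≤ P.εg / P.εH ∧
      (‖R.g k ω‖ < P.εg ∧ R.dir k ω = 0 ∨
        P.εg ≤ ‖R.g k ω‖ ∧ R.cgType k ω = DirType.SOL ∧ R.dir k ω = R.cgDir k ω) := by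
  obtain ⟨o, hit, ho⟩ := hR.iteration k ω hk
  cases hit with
  | cgNC | cgSol | smallSolNC | smallGradNC => exact absurd hk1 ho.2.1
  | smallSolStop hg ht hu ha =>
    obtain ⟨hd, -, hx⟩ := ho
    exact ⟨ha, Or.inr ⟨hg, ht, hu⟩, by rw [hd, hx], by rwa [hd], Or.inr ⟨hg, ht, hd⟩⟩
  | smallGradStop hg ha =>
    obtain ⟨hd, -, hx⟩ := ho
    refine ⟨ha, Or.inl hg, by rw [hd, hx, add_zero], ?_, Or.inl ⟨hg, hd⟩⟩
    rw [hd, norm_zero]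
    exact (div_pos hP.εg_pos hP.εH_pos).le

/-- The residual of an accurate solution is small compared with the solution. -/
theorem residual_le (hP : P.Valid) {u g : Vec d} {H : Mat d} (hH : ‖H‖ ≤ P.UH)
    (h : ‖g + CappedCG.damped H P.εH u‖ ≤ CappedCG.zetaHat P.UH P.εH P.ζ * ‖g‖) :
    ‖g + CappedCG.damped H P.εH u‖ ≤ P.εH * ‖u‖ / 2 := by
  have he := hP.εH_pos
  have hζ := hP.ζ_pos
  have hζ1 : P.ζ < 1 := hP.ζ_lt.trans_le (min_le_left _ _)
  have hκ := CappedCG.two_le_kappa hP.UH_pos.le he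
  have hz := CappedCG.zetaHat_nonneg (ζ := P.ζ) hP.UH_pos.le he hζ
  have hzκ : CappedCG.zetaHat P.UH P.εH P.ζ * CappedCG.kappa P.UH P.εH = P.ζ / 3 := by
    unfold CappedCG.zetaHat
    field_simp
  have hL : P.UH + 2 * P.εH = CappedCG.kappa P.UH P.εH * P.εH := by
    rw [CappedCG.kappa, div_mul_cancel₀ _ he.ne']
  have h1 : ‖CappedCG.damped H P.εH u‖ ≤ CappedCG.kappa P.UH P.εH * P.εH * ‖u‖ := by
    rw [← hL, CappedCG.damped_apply]
    refine (norm_add_le _ _).trans ?_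
    have := H.le_of_opNorm_le hH u
    rw [norm_smul, Real.norm_of_nonneg (by positivity)]
    linarith
  have h2 : ‖g‖ ≤ ‖g + CappedCG.damped H P.εH u‖ + ‖CappedCG.damped H P.εH u‖ := by
    simpa using norm_sub_le (g + CappedCG.damped H P.εH u) (CappedCG.damped H P.εH u)
  set r := ‖g + CappedCG.damped H P.εH u‖ with hr
  set z := CappedCG.zetaHat P.UH P.εH P.ζ
  -- The factor κ in the test accuracy cancels ‖H̄‖ ≤ κε_H and so eliminates ‖g‖; with z ≤ 1/6 the
  -- residual is absorbed on the left.
  have h3 : z * ‖g‖ ≤ z * r + P.ζ / 3 * (P.εH * ‖u‖) := by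
    have := mul_le_mul_of_nonneg_left (h2.trans (add_le_add_right h1 r)) hz
    rw [← hzκ]
    linarith
  have hz6 : z ≤ 1 / 6 := by nlinarith
  have hr0 : 0 ≤ r := norm_nonneg _
  have heu : 0 ≤ P.εH * ‖u‖ := by positivity
  nlinarith [mul_le_mul_of_nonneg_right hz6 hr0, mul_le_mul_of_nonneg_right hζ1.le heu]

theorem norm_gradient_halting_le (hP : P.Valid) (hε : 0 < ε) (hεg : P.εg = ε)
    (hεH : P.εH = √(P.LH * ε)) (hR : IsRun P x₀ μ ℱ R)
    (hS : SmoothnessAssumption f x₀ flow Lg P.LH R) (hI : InexactnessCondition P f R)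
    {k : ℕ} {ω : Ω} (hk : ¬ R.stopped k ω) (hk1 : R.stopped (k + 1) ω) :
    ‖gradient f (R.x (k + 1) ω)‖ ≤ 4 * ε := by
  obtain ⟨-, -, hx, hdn, hcase⟩ := hR.halting hP hk hk1
  have hδ := hI.δg_le_eps hP hε hεH hk
  have hg := hI.gradient_accuracy k ω hk
  rcases hcase with ⟨hgs, hd⟩ | ⟨hgl, ht, hd⟩
  · rw [hx, hd, add_zero]
    have := norm_sub_norm_le (gradient f (R.x k ω)) (R.g k ω)
    rw [norm_sub_rev] at this
    linarith
  · have he := hP.εH_pos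
    have hLH := hP.LH_pos
    have hζ := hP.ζ_pos
    have he2 : P.εH ^ 2 = P.LH * ε := by rw [hεH, Real.sq_sqrt (by positivity)]
    have htay := norm_gradient_sub_le hS.contDiff (hS.hessian_dir hk)
      (Set.right_mem_Icc.mpr zero_le_one)
    have hres := residual_le hP (hR.hessians k ω hk).2 (hR.solution hP hk hgl ht).2.2
    have hH := hI.hessian_accuracy k ω hk
    rw [← hd] at hres
    simp only [one_smul, one_pow, mul_one] at htay
    rw [← hx] at htay
    set u := R.dir k ω
    set r := R.g k ω + CappedCG.damped (R.H k ω) P.εH u with hr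
    have hHu := ContinuousLinearMap.le_of_opNorm_le _ hH u
    have hu : P.εH * ‖u‖ ≤ ε := by
      rw [hεg, le_div_iff₀ he] at hdn
      linarith
    have hu2 : P.LH * ‖u‖ ^ 2 ≤ ε := by
      have h1 : (P.εH * ‖u‖) ^ 2 ≤ ε ^ 2 := pow_le_pow_left₀ (by positivity) hu 2
      rw [mul_pow, he2] at h1
      nlinarith
    have hδu : P.δH * ‖u‖ ≤ ε / 4 := by
      have h1 := mul_le_mul_of_nonneg_right hI.δH_le (norm_nonneg u)
      nlinarith [mul_nonneg he.le (norm_nonneg u)]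
    -- The five terms are at most ε/2, ε/8, ε/4, 2ε and ε/2, in total less than 4ε.
    have hdecomp : gradient f (R.x (k + 1) ω) =
        (gradient f (R.x (k + 1) ω) - gradient f (R.x k ω) - hessian f (R.x k ω) u) -
        (R.g k ω - gradient f (R.x k ω)) - (R.H k ω - hessian f (R.x k ω)) u -
        (2 * P.εH) • u + r := by
      rw [hr, CappedCG.damped_apply, _root_.sub_apply]
      abel
    have h2u : ‖(2 * P.εH) • u‖ = 2 * P.εH * ‖u‖ := by
      rw [norm_smul, Real.norm_of_nonneg (by positivity)]
    rw [hdecomp]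
    refine (norm_add_le _ _).trans ?_
    have t1 := norm_sub_le ((gradient f (R.x (k + 1) ω) - gradient f (R.x k ω) -
      hessian f (R.x k ω) u) - (R.g k ω - gradient f (R.x k ω)) -
        (R.H k ω - hessian f (R.x k ω)) u) ((2 * P.εH) • u)
    have t2 := norm_sub_le ((gradient f (R.x (k + 1) ω) - gradient f (R.x k ω) -
      hessian f (R.x k ω) u) - (R.g k ω - gradient f (R.x k ω)))
        ((R.H k ω - hessian f (R.x k ω)) u)
    have t3 := norm_sub_le (gradient f (R.x (k + 1) ω) - gradient f (R.x k ω) -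
      hessian f (R.x k ω) u) (R.g k ω - gradient f (R.x k ω))
    linarith

theorem lambdaMin_halting_ge (hP : P.Valid) (hε : 0 < ε) (hεg : P.εg = ε)
    (hεH : P.εH = √(P.LH * ε)) (hR : IsRun P x₀ μ ℱ R)
    (hS : SmoothnessAssumption f x₀ flow Lg P.LH R) (hI : InexactnessCondition P f R)
    {k : ℕ} {ω : Ω} (hk : ¬ R.stopped k ω) (hk1 : R.stopped (k + 1) ω)
    (hmin : -P.εH ≤ lambdaMin (R.H k ω)) :
    -(3 * √(P.LH * ε)) ≤ lambdaMin (hessian f (R.x (k + 1) ω)) := by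
  obtain ⟨-, -, hx, hdn, -⟩ := hR.halting hP hk hk1
  have he := hP.εH_pos
  have hLH := hP.LH_pos
  have hζ := hP.ζ_pos
  have he2 : P.εH ^ 2 = P.LH * ε := by rw [hεH, Real.sq_sqrt (by positivity)]
  have h1 := hS.hessian_dir hk _ (right_mem_segment ℝ _ _)
  rw [← hx, hx, add_sub_cancel_left, ← hx] at h1
  have h2 : P.LH * ‖R.dir k ω‖ ≤ P.εH := by
    rw [hεg, le_div_iff₀ he] at hdn
    have : P.LH * ‖R.dir k ω‖ * P.εH ≤ P.εH * P.εH := by nlinarith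
    exact le_of_mul_le_mul_right this he
  -- δ_H is at most ε_H/4, and the Hessian changes by at most L_H‖d_k‖ ≤ ε_H along the last step.
  have h3 : ‖R.H k ω - hessian f (R.x (k + 1) ω)‖ ≤ 2 * P.εH := by
    have h4 := norm_sub_le_norm_sub_add_norm_sub (R.H k ω) (hessian f (R.x k ω))
      (hessian f (R.x (k + 1) ω))
    have h5 := hI.hessian_accuracy k ω hk
    rw [norm_sub_rev (hessian f (R.x k ω))] at h4
    have h6 := hI.δH_le
    nlinarith
  rw [← hεH]
  refine le_lambdaMin (by linarith) fun v => ?_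
  have h4 := lambdaMin_mul_le (hR.hessians k ω hk).1 v
  have h5 := mul_le_mul_of_nonneg_right hmin (sq_nonneg ‖v‖)
  have h6 := (le_abs_self _).trans
    (abs_real_inner_le_norm v ((R.H k ω - hessian f (R.x (k + 1) ω)) v))
  have h7 := mul_le_mul_of_nonneg_left (ContinuousLinearMap.le_of_opNorm_le _ h3 v)
    (norm_nonneg v)
  rw [_root_.sub_apply, inner_sub_right] at h6
  rw [_root_.sub_apply] at h7
  linarith

/-! ### The probability of a wrong certificate -/

theorem measurableSet_callsOracle (hR : IsRun P x₀ μ ℱ R) (k : ℕ) :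
    MeasurableSet[ℱ k] {ω | CallsOracle P (R.g k ω) (R.cgType k ω) (R.cgDir k ω)} := by
  have hg : Measurable[ℱ k] fun ω => ‖R.g k ω‖ := measurable_norm.comp (hR.measurable_g k)
  have hu : Measurable[ℱ k] fun ω => ‖R.cgDir k ω‖ :=
    measurable_norm.comp (hR.measurable_cgDir k)
  exact MeasurableSet.union (hg measurableSet_Iio) (MeasurableSet.inter (hg measurableSet_Ici)
    (MeasurableSet.inter (hR.measurable_cgType k) (hu measurableSet_Iic)))

/-- For symmetric matrices λ_min < -ε_H means that some v violates the quadratic form bound, an open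
condition on the matrix. This avoids measurability of `lambdaMin`; symmetry is known only before the
halt, hence the intersection. -/
theorem measurableSet_criticalCall (hP : P.Valid) (hR : IsRun P x₀ μ ℱ R) (k : ℕ) :
    MeasurableSet[ℱ k] (criticalCall P R k) := by
  have hopen : IsOpen {A : Mat d | ∃ v : Vec d, inner ℝ v (A v) < -P.εH * ‖v‖ ^ 2} := by
    rw [Set.ofPred_exists]
    refine isOpen_iUnion fun v => isOpen_lt ?_ continuous_const
    fun_prop
  have h1 : MeasurableSet[ℱ k]
      {ω | ∃ v : Vec d, inner ℝ v (R.H k ω v) < -P.εH * ‖v‖ ^ 2} :=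
    hR.measurable_H k hopen.measurableSet
  have heq : criticalCall P R k = {ω | R.stopped k ω}ᶜ ∩
      ({ω | CallsOracle P (R.g k ω) (R.cgType k ω) (R.cgDir k ω)} ∩
        {ω | ∃ v : Vec d, inner ℝ v (R.H k ω v) < -P.εH * ‖v‖ ^ 2}) := by
    ext ω
    simp only [criticalCall, Set.mem_ofPred_eq, Set.mem_inter_iff, Set.mem_compl_iff]
    refine and_congr_right fun hk => and_congr_right fun _ => ⟨fun h => ?_, fun ⟨v, hv⟩ => ?_⟩
    · by_contra hno
      push Not at hno
      exact absurd (le_lambdaMin (by linarith [hP.εH_pos]) hno) (not_le.mpr h)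
    · have := (lambdaMin_mul_le (hR.hessians k ω hk).1 v).trans_lt hv
      exact lt_of_mul_lt_mul_right this (sq_nonneg _)
  rw [heq]
  exact (hR.measurable_stopped k).compl.inter ((measurableSet_callsOracle hR k).inter h1)

theorem measurableSet_reliable (hP : P.Valid) (hR : IsRun P x₀ μ ℱ R) (n : ℕ) :
    MeasurableSet[ℱ n] (reliable P R n) := by
  induction n with
  | zero => simp [reliable]
  | succ n ih =>
    rw [reliable_succ]
    have hle : ℱ n ≤ ℱ (n + 1) := ℱ.mono n.le_succ
    exact (hle _ ih).diff (((hle _ ih).inter (hle _ (measurableSet_criticalCall hP hR n))).inter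
      (hR.measurable_certificate n))

/-- Reliability before iteration n is known at time n, so the conditional failure bound applies on
it: each iteration removes at most the fraction δ of the reliable event. -/
theorem pow_le_measure_reliable [IsProbabilityMeasure μ] (hP : P.Valid)
    (hR : IsRun P x₀ μ ℱ R) (n : ℕ) : (1 - P.δ) ^ n ≤ μ.real (reliable P R n) := by
  induction n with
  | zero => simp [reliable]
  | succ n ih =>
    have hG := measurableSet_reliable hP hR n
    have hA : MeasurableSet[ℱ n] (reliable P R n ∩ criticalCall P R n) :=
      hG.inter (measurableSet_criticalCall hP hR n)
    have hfail := hR.oracle_failure n _ hA fun ω hω => hω.2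
    have hfail' : μ.real (reliable P R n ∩ criticalCall P R n ∩ {ω | R.oracle n ω = none}) ≤
        P.δ * μ.real (reliable P R n ∩ criticalCall P R n) := by
      have := ENNReal.toReal_mono (ENNReal.mul_ne_top ENNReal.ofReal_ne_top (measure_ne_top μ _))
        hfail
      rwa [ENNReal.toReal_mul, ENNReal.toReal_ofReal hP.δ_nonneg] at this
    have hmono : μ.real (reliable P R n ∩ criticalCall P R n) ≤ μ.real (reliable P R n) :=
      measureReal_mono Set.inter_subset_left
    have hmeas : MeasurableSet
        (reliable P R n ∩ criticalCall P R n ∩ {ω | R.oracle n ω = none}) :=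
      (ℱ.le n _ hA).inter (ℱ.le (n + 1) _ (hR.measurable_certificate n))
    rw [reliable_succ, measureReal_sdiff (Set.inter_subset_left.trans Set.inter_subset_left) hmeas,
      pow_succ']
    have h1 := mul_le_mul_of_nonneg_left ih (show 0 ≤ 1 - P.δ by linarith [hP.δ_lt])
    have h2 := mul_le_mul_of_nonneg_left hmono hP.δ_nonneg
    linarith

end InexactNewtonCG

end

theorem theorem2 :
    -- constants that depend on nothing at all
    ∃ C₁ C₂ : ℝ, 0 < C₁ ∧ 0 < C₂ ∧
    ∀ (d : ℕ) (f : InexactNewtonCG.Vec d → ℝ) (x₀ : InexactNewtonCG.Vec d) (flow Lg ε : ℝ)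
      (P : InexactNewtonCG.Params)
      (Ω : Type*) (mΩ : MeasurableSpace Ω) (μ : MeasureTheory.Measure Ω)
      (ℱ : MeasureTheory.Filtration ℕ mΩ) (R : InexactNewtonCG.Trace Ω d),
      MeasureTheory.IsProbabilityMeasure μ →
      0 < ε → P.Valid → P.εg = ε → P.εH = √(P.LH * ε) →
      InexactNewtonCG.IsRun P x₀ μ ℱ R →
      InexactNewtonCG.SmoothnessAssumption f x₀ flow Lg P.LH R →
      InexactNewtonCG.InexactnessCondition P f R →
      -- every call of the capped CG procedure terminates
      (∀ k ω, ¬ R.stopped k ω → P.εg ≤ ‖R.g k ω‖ →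
        ∃ t u, InexactNewtonCG.CappedCG.Returns (R.H k ω) (R.g k ω) P.εH P.ζ P.UH t u) ∧
      -- termination within the iteration bound, at an approximate first-order point
      (∀ ω, R.stopped (InexactNewtonCG.iterationBound P (f x₀ - flow) ε) ω ∧
        ‖gradient f (R.x (InexactNewtonCG.iterationBound P (f x₀ - flow) ε) ω)‖ ≤ C₁ * ε) ∧
      -- with the stated probability, the returned point is an approximate second-order point
      (1 - P.δ) ^ InexactNewtonCG.iterationBound P (f x₀ - flow) ε ≤
        μ.real {ω | R.stopped (InexactNewtonCG.iterationBound P (f x₀ - flow) ε) ω ∧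
          -(C₂ * √(P.LH * ε)) ≤ InexactNewtonCG.lambdaMin
            (InexactNewtonCG.hessian f
              (R.x (InexactNewtonCG.iterationBound P (f x₀ - flow) ε) ω))} := by
  refine ⟨4, 3, by norm_num, by norm_num, ?_⟩
  intro d f x₀ flow Lg ε P Ω mΩ μ ℱ R hμ hε hP hεg hεH hR hS hI
  have hterm := InexactNewtonCG.stopped_iterationBound hP hε hεg hεH hR hS hI
  refine ⟨fun k ω hk hg => hR.exists_returns hP hk hg, fun ω => ⟨hterm ω, ?_⟩, ?_⟩
  · obtain ⟨k, -, hk, hk1, hx⟩ := hR.exists_halting (hterm ω)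
    rw [hx]
    exact InexactNewtonCG.norm_gradient_halting_le hP hε hεg hεH hR hS hI hk hk1
  · refine (InexactNewtonCG.pow_le_measure_reliable hP hR _).trans
      (MeasureTheory.measureReal_mono fun ω hω => ⟨hterm ω, ?_⟩)
    -- The halting index lies strictly below the iteration bound, so reliability up to the bound
    -- covers the final certificate.
    obtain ⟨k, hkn, hk, hk1, hx⟩ := hR.exists_halting (hterm ω)
    obtain ⟨hnone, hcall, -⟩ := hR.halting hP hk hk1
    rw [hx]
    refine InexactNewtonCG.lambdaMin_halting_ge hP hε hεg hεH hR hS hI hk hk1 ?_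
    by_contra hlt
    exact hω k hkn ⟨⟨hk, hcall, not_le.mp hlt⟩, hnone⟩
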